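/- Let $A$ and $B$ be rings (associative, with identity), let $U$ be a $(B,A)$-bimodule, and let $T=\begin{pmatrix}A&0\\U&B\end{pmatrix}$ be the triangular matrix ring. Modules are left modules. For an $A$-module $M_1$ and a $B$-module $M_2$ let $\mathbf{p}(M_1,M_2)=\begin{pmatrix}M_1\\(U\otimes_AM_1)\oplus M_2\end{pmatrix}$ be the $T$-module with action $\begin{pmatrix}a&0\\u&b\end{pmatrix}\begin{pmatrix}x\\(t,y)\end{pmatrix}=\begin{pmatrix}ax\\(u\otimes x+bt,\;by)\end{pmatrix}$. Definitions. For a ring $R$ and an $R$-module $C$, let $\mathrm{Add}_R(C)$ be the class of modules isomorphic to direct summands of direct sums $C^{(I)}$ of copies of $C$. An exact sequence is $\mathrm{Hom}_R(-,\mathrm{Add}_R(C))$-exact if it stays exact under $\mathrm{Hom}_R(-,F)$ for every $F\in\mathrm{Add}_R(C)$. Call a $\mathrm{Hom}_R(-,\mathrm{Add}_R(C))$-exact exact sequence $$\cdots\to P_1\to P_0\to C^0\to C^1\to\cdots$$ with all $P_i$ projective and all $C^i\in\mathrm{Add}_R(C)$ a *$C$-complete sequence*. An $R$-module $M$ is $G_C$-projective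 if $M\cong\mathrm{Im}(P_0\to C^0)$ for some $C$-complete sequence. It is Gorenstein projective if it is isomorphic to the image of a map in an exact sequence of projective modules, unbounded in both directions, that stays exact under $\mathrm{Hom}_R(-,Q)$ for every projective module $Q$. The module $C$ is w-tilting if $\mathrm{Ext}_R^i(C,C^{(I)})=0$ for all $i\ge1$ and all sets $I$, and there is a $\mathrm{Hom}_R(-,\mathrm{Add}_R(C))$-exact exact sequence $0\to R\to A^0\to A^1\to\cdots$ with all $A^i\in\mathrm{Add}_R(C)$. Let $C_1$ be an $A$-module, $C_2$ a $B$-module and $C=\mathbf{p}(C_1,C_2)$. The bimodule $U$ is weakly $C$-compatible if (a$'$) $U\otimes_A\mathbf{X}_1$ is exact for every $C_1$-complete sequence $\mathbf{X}_1$ of $A$-modules, and (b) $\mathrm{Hom}_B(\mathbf{X}_2,U\otimes_AY)$ is exact for every $C_2$-complete sequence $\mathbf{X}_2$ of $B$-modules and every $Y\in\mathrm{Add}_A(C_1)$. It is weakly compatible if this holds for $C_1=A$, $C_2=B$, so that $C=\mathbf{p}(A,B)\cong{}_TT$. Proposition. 1. For all $C_1,C_2$, with $C=\mathbf{p}(C_1,C_2)$: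 if $U$ is weakly $C$-compatible, then $\mathbf{p}(M_1,M_2)$ is a $G_C$-projective $T$-module for every $G_{C_1}$-projective $A$-module $M_1$ and every $G_{C_2}$-projective $B$-module $M_2$. 2. Conversely, if $C_1$ and $C_2$ are w-tilting and $\mathbf{p}(M_1,M_2)$ is $G_C$-projective whenever $M_1$ is $G_{C_1}$-projective and $M_2$ is $G_{C_2}$-projective, then $U$ is weakly $C$-compatible. 3. In particular, $\mathbf{p}(M_1,M_2)$ is a Gorenstein projective $T$-module for all Gorenstein projective $A$-modules $M_1$ and all Gorenstein projective $B$-modules $M_2$ if and only if $U$ is weakly compatible. -/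

import Mathlib

open scoped TensorProduct MulOpposite

universe u

/-! ### Relative Gorenstein homological notions over an arbitrary ring (left modules) -/

section Relative

variable (R : Type u) [Ring R]

/-- `X` is in `Add_R(C)`: it is isomorphic to a direct summand (that is, a retract) of a direct sum
`C^(I)` of copies of `C`. -/
def InAdd (C X : Type u) [AddCommGroup C] [Module R C] [AddCommGroup X] [Module R X] : Prop :=
  ∃ (I : Type u) (s : X →ₗ[R] (I →₀ C)) (r : (I →₀ C) →ₗ[R] X), r ∘ₗ s = LinearMap.id

/-- A sequence `⋯ → X (-1) → X 0 → X 1 → X 2 → ⋯` of `R`-modules and `R`-linear maps. -/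
structure ModSeq where
  /-- the terms -/
  X : ℤ → ModuleCat.{u} R
  /-- the maps -/
  d : ∀ i : ℤ, X i →ₗ[R] X (i + 1)

variable {R}

/-- The sequence is exact at every term. -/
def ModSeq.IsExact (S : ModSeq R) : Prop :=
  ∀ i : ℤ, Function.Exact (S.d i) (S.d (i + 1))

/-- The sequence stays exact under the contravariant functor `Hom_R(-, F)`. -/
def ModSeq.HomExact (S : ModSeq R) (F : Type u) [AddCommGroup F] [Module R F] : Prop :=
  ∀ i : ℤ, Function.Exact
    (fun f : S.X (i + 1 + 1) →ₗ[R] F => f ∘ₗ S.d (i + 1))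
    (fun f : S.X (i + 1) →ₗ[R] F => f ∘ₗ S.d i)

/-- The sequence is `Hom_R(-, Add_R(C))`-exact. -/
def ModSeq.HomAddExact (S : ModSeq R) (C : Type u) [AddCommGroup C] [Module R C] : Prop :=
  ∀ F : ModuleCat.{u} R, InAdd R C F → S.HomExact F

/-- The sequence has the shape `⋯ → P₁ → P₀ → C⁰ → C¹ → ⋯` with all `Pᵢ` projective and all
`Cⁱ` in `Add_R(C)`; here `P₀` is the term of index `0` and `C⁰` the term of index `1`. -/
def ModSeq.IsProjAdd (S : ModSeq R) (C : Type u) [AddCommGroup C] [Module R C] : Prop :=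
  (∀ i : ℤ, i ≤ 0 → Module.Projective R (S.X i)) ∧ (∀ i : ℤ, 0 < i → InAdd R C (S.X i))

variable (R)

/-- `M` is `G_C`-projective. -/
def IsGCProjective (C M : Type u) [AddCommGroup C] [Module R C] [AddCommGroup M] [Module R M] :
    Prop :=
  ∃ S : ModSeq R, S.IsProjAdd C ∧ S.IsExact ∧ S.HomAddExact C ∧
    Nonempty (M ≃ₗ[R] LinearMap.range (S.d 0))

/-- `M` is Gorenstein projective: it is isomorphic to the image of a map of an exact sequence of
projective modules that stays exact under `Hom_R(-, Q)` for every projective module `Q`. -/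
def IsGorensteinProjective (M : Type u) [AddCommGroup M] [Module R M] : Prop :=
  ∃ S : ModSeq R, (∀ i, Module.Projective R (S.X i)) ∧ S.IsExact ∧
    (∀ Q : ModuleCat.{u} R, Module.Projective R Q → S.HomExact Q) ∧
    Nonempty (M ≃ₗ[R] LinearMap.range (S.d 0))

/-- `C` is weakly Wakamatsu tilting (w-tilting): `Ext^i_R(C, C^(I)) = 0` for all `i ≥ 1` and all
sets `I`, and there is a `Hom_R(-, Add_R(C))`-exact exact sequence `0 → R → A⁰ → A¹ → ⋯` with all
`Aⁱ` in `Add_R(C)`. The sequence is extended by zeros to the left; `R` has index `0`. -/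
def IsWTilting (C : Type u) [AddCommGroup C] [Module R C] : Prop :=
  (∀ (I : Type u) (n : ℕ), 1 ≤ n →
    Subsingleton (CategoryTheory.Abelian.Ext.{u} (ModuleCat.of R C) (ModuleCat.of R (I →₀ C)) n)) ∧
  ∃ S : ModSeq R, (∀ i : ℤ, i < 0 → Subsingleton (S.X i)) ∧ Nonempty (S.X 0 ≃ₗ[R] R) ∧
    (∀ i : ℤ, 0 < i → InAdd R C (S.X i)) ∧ S.IsExact ∧ S.HomAddExact C

end Relative

/-! ### The tensor product over a not necessarily commutative ring

A `(B, A)`-bimodule is a left `B`-module `U` that is also a right `A`-module, i.e. a module over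
the opposite ring of `A`, with commuting actions. -/

section Tensor

variable (A B U : Type u) [Ring A] [Ring B] [AddCommGroup U] [Module B U] [Module Aᵐᵒᵖ U]

/-- The relations `(u a) ⊗ m = u ⊗ (a m)` that cut `U ⊗_A M` out of `U ⊗_ℤ M`. As the two actions on
`U` commute, the generators are stable under `B`, so their `B`-span is their additive span. -/
def tensorRel (M : Type u) [AddCommGroup M] [Module A M] : Submodule B (U ⊗[ℤ] M) :=
  Submodule.span B
    {t | ∃ (x : U) (a : A) (m : M), t = (MulOpposite.op a • x) ⊗ₜ[ℤ] m - x ⊗ₜ[ℤ] (a • m)}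

/-- The left `B`-module `U ⊗_A M`. -/
abbrev BTensor (M : Type u) [AddCommGroup M] [Module A M] : Type u :=
  (U ⊗[ℤ] M) ⧸ tensorRel A B U M

variable {U} in
/-- The element `x ⊗ m` of `U ⊗_A M`. -/
def btmul {M : Type u} [AddCommGroup M] [Module A M] (x : U) (m : M) : BTensor A B U M :=
  (tensorRel A B U M).mkQ (x ⊗ₜ[ℤ] m)

/-- The `B`-linear map `1_U ⊗ f : U ⊗_A M → U ⊗_A N`. -/
noncomputable def btensorMap {M N : Type u} [AddCommGroup M] [Module A M] [AddCommGroup N]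
    [Module A N] (f : M →ₗ[A] N) : BTensor A B U M →ₗ[B] BTensor A B U N :=
  (tensorRel A B U M).mapQ (tensorRel A B U N)
    (TensorProduct.AlgebraTensorModule.lTensor B U f.toAddMonoidHom.toIntLinearMap) <| by
      refine Submodule.span_le.2 ?_
      rintro _ ⟨x, a, m, rfl⟩
      refine Submodule.subset_span ⟨x, a, f m, ?_⟩
      simp

theorem btmul_add_left {M : Type u} [AddCommGroup M] [Module A M] (x y : U) (m : M) :
    btmul A B (x + y) m = btmul A B x m + btmul A B y m := by
  simp [btmul, TensorProduct.add_tmul]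

theorem btmul_add_right {M : Type u} [AddCommGroup M] [Module A M] (x : U) (m n : M) :
    btmul A B x (m + n) = btmul A B x m + btmul A B x n := by
  simp [btmul, TensorProduct.tmul_add]

theorem btmul_zero_left {M : Type u} [AddCommGroup M] [Module A M] (m : M) :
    btmul A B (0 : U) m = 0 := by
  simp [btmul]

theorem btmul_zero_right {M : Type u} [AddCommGroup M] [Module A M] (x : U) :
    btmul A B x (0 : M) = 0 := by
  simp [btmul]

theorem smul_btmul {M : Type u} [AddCommGroup M] [Module A M] (b : B) (x : U) (m : M) :
    b • btmul A B x m = btmul A B (b • x) m := by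
  simp only [btmul, ← map_smul, TensorProduct.smul_tmul']

theorem btmul_smul {M : Type u} [AddCommGroup M] [Module A M] (x : U) (a : A) (m : M) :
    btmul A B x (a • m) = btmul A B (MulOpposite.op a • x) m := by
  symm
  refine (Submodule.Quotient.eq (tensorRel A B U M)).2 ?_
  exact Submodule.subset_span ⟨x, a, m, rfl⟩

end Tensor

/-! ### The triangular matrix ring `T = (A 0; U B)` and its modules -/

/-- The underlying set of the ring of matrices `(a 0; u b)`. -/
@[ext]
structure TriRing (A B U : Type u) where
  /-- the upper left entry -/
  a : A
  /-- the lower left entry -/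
  u : U
  /-- the lower right entry -/
  b : B

namespace TriRing

variable {A B U : Type u} [Ring A] [Ring B] [AddCommGroup U]

instance : Zero (TriRing A B U) := ⟨⟨0, 0, 0⟩⟩
instance : One (TriRing A B U) := ⟨⟨1, 0, 1⟩⟩
instance : Add (TriRing A B U) := ⟨fun s t => ⟨s.a + t.a, s.u + t.u, s.b + t.b⟩⟩
instance : Neg (TriRing A B U) := ⟨fun s => ⟨-s.a, -s.u, -s.b⟩⟩

@[simp] theorem zero_a : (0 : TriRing A B U).a = 0 := rfl
@[simp] theorem zero_u : (0 : TriRing A B U).u = 0 := rfl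
@[simp] theorem zero_b : (0 : TriRing A B U).b = 0 := rfl
@[simp] theorem one_a : (1 : TriRing A B U).a = 1 := rfl
@[simp] theorem one_u : (1 : TriRing A B U).u = 0 := rfl
@[simp] theorem one_b : (1 : TriRing A B U).b = 1 := rfl
@[simp] theorem add_a (s t : TriRing A B U) : (s + t).a = s.a + t.a := rfl
@[simp] theorem add_u (s t : TriRing A B U) : (s + t).u = s.u + t.u := rfl
@[simp] theorem add_b (s t : TriRing A B U) : (s + t).b = s.b + t.b := rfl
@[simp] theorem neg_a (s : TriRing A B U) : (-s).a = -s.a := rfl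
@[simp] theorem neg_u (s : TriRing A B U) : (-s).u = -s.u := rfl
@[simp] theorem neg_b (s : TriRing A B U) : (-s).b = -s.b := rfl

variable [Module B U] [Module Aᵐᵒᵖ U]

/-- Matrix multiplication: `(a 0; u b) (a' 0; u' b') = (a a' 0; u a' + b u', b b')`. -/
instance : Mul (TriRing A B U) :=
  ⟨fun s t => ⟨s.a * t.a, MulOpposite.op t.a • s.u + s.b • t.u, s.b * t.b⟩⟩

@[simp] theorem mul_a (s t : TriRing A B U) : (s * t).a = s.a * t.a := rfl
@[simp] theorem mul_u (s t : TriRing A B U) :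
    (s * t).u = MulOpposite.op t.a • s.u + s.b • t.u := rfl
@[simp] theorem mul_b (s t : TriRing A B U) : (s * t).b = s.b * t.b := rfl

instance [SMulCommClass B Aᵐᵒᵖ U] : Ring (TriRing A B U) where
  add_assoc r s t := by ext <;> simp [add_assoc]
  zero_add s := by ext <;> simp
  add_zero s := by ext <;> simp
  add_comm s t := by ext <;> simp [add_comm]
  nsmul := nsmulRec
  zsmul := zsmulRec
  neg_add_cancel s := by ext <;> simp
  mul_assoc r s t := by
    ext
    · simp [mul_assoc]
    · simp [mul_smul, smul_comm, add_assoc]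
    · simp [mul_assoc]
  one_mul s := by ext <;> simp
  mul_one s := by ext <;> simp
  left_distrib r s t := by
    ext
    · simp [mul_add]
    · simp only [mul_u, add_u, add_a, MulOpposite.op_add, add_smul, smul_add]; abel
    · simp [mul_add]
  right_distrib r s t := by
    ext
    · simp [add_mul]
    · simp only [mul_u, add_u, add_b, add_smul, smul_add]; abel
    · simp [add_mul]
  zero_mul s := by ext <;> simp
  mul_zero s := by ext <;> simp

end TriRing

section TriMod

variable {A B U : Type u} [Ring A] [Ring B] [AddCommGroup U] [Module B U] [Module Aᵐᵒᵖ U]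

/-- The left `T`-module `(M₁; M₂)_φ` given by a left `A`-module `M₁`, a left `B`-module `M₂` and a
`B`-linear map `φ : U ⊗_A M₁ → M₂`. Its elements are the columns `(x; y)`. -/
def TriMod {M₁ M₂ : Type u} [AddCommGroup M₁] [Module A M₁] [AddCommGroup M₂] [Module B M₂]
    (_φ : BTensor A B U M₁ →ₗ[B] M₂) : Type u :=
  M₁ × M₂

variable {M₁ M₂ : Type u} [AddCommGroup M₁] [Module A M₁] [AddCommGroup M₂] [Module B M₂]
  (φ : BTensor A B U M₁ →ₗ[B] M₂)

instance : AddCommGroup (TriMod φ) := inferInstanceAs (AddCommGroup (M₁ × M₂))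

/-- The action `(a 0; u b) (x; y) = (a x; φ(u ⊗ x) + b y)`. -/
instance : SMul (TriRing A B U) (TriMod φ) :=
  ⟨fun t m => (t.a • m.1, φ (btmul A B t.u m.1) + t.b • m.2)⟩

theorem TriMod.smul_def (t : TriRing A B U) (m : TriMod φ) :
    t • m = ((t.a • m.1, φ (btmul A B t.u m.1) + t.b • m.2) : M₁ × M₂) := rfl

instance [SMulCommClass B Aᵐᵒᵖ U] : Module (TriRing A B U) (TriMod φ) where
  one_smul m := by
    refine Prod.ext ?_ ?_ <;> simp [TriMod.smul_def, btmul_zero_left]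
  mul_smul s t m := by
    refine Prod.ext ?_ ?_
    · exact mul_smul s.a t.a m.1
    · change φ (btmul A B (MulOpposite.op t.a • s.u + s.b • t.u) m.1) + (s.b * t.b) • m.2 =
        φ (btmul A B s.u (t.a • m.1)) + s.b • (φ (btmul A B t.u m.1) + t.b • m.2)
      rw [btmul_add_left, map_add, btmul_smul, smul_add, ← smul_btmul, map_smul, mul_smul,
        add_assoc]
  smul_zero t := by
    refine Prod.ext ?_ ?_
    · exact smul_zero t.a
    · change φ (btmul A B t.u (0 : M₁)) + t.b • (0 : M₂) = 0
      simp [btmul_zero_right]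
  zero_smul m := by
    refine Prod.ext ?_ ?_
    · exact zero_smul A m.1
    · change φ (btmul A B (0 : U) m.1) + (0 : B) • m.2 = 0
      simp [btmul_zero_left]
  smul_add t m n := by
    refine Prod.ext ?_ ?_
    · exact smul_add t.a m.1 n.1
    · change φ (btmul A B t.u (m.1 + n.1)) + t.b • (m.2 + n.2) =
        φ (btmul A B t.u m.1) + t.b • m.2 + (φ (btmul A B t.u n.1) + t.b • n.2)
      rw [btmul_add_right, map_add, smul_add]; abel
  add_smul s t m := by
    refine Prod.ext ?_ ?_
    · exact add_smul s.a t.a m.1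
    · change φ (btmul A B (s.u + t.u) m.1) + (s.b + t.b) • m.2 =
        φ (btmul A B s.u m.1) + s.b • m.2 + (φ (btmul A B t.u m.1) + t.b • m.2)
      rw [btmul_add_left, map_add, add_smul]; abel

variable (A B U) in
/-- The left `T`-module `p(M₁, M₂) = (M₁; (U ⊗_A M₁) ⊕ M₂)`, whose structure map is the inclusion of
`U ⊗_A M₁`. -/
abbrev PMod (M₁ M₂ : Type u) [AddCommGroup M₁] [Module A M₁] [AddCommGroup M₂] [Module B M₂] :
    Type u :=
  TriMod (LinearMap.inl B (BTensor A B U M₁) M₂)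

end TriMod

/-! ### Weakly compatible bimodules -/

section Compatible

variable (A B U : Type u) [Ring A] [Ring B] [AddCommGroup U] [Module B U] [Module Aᵐᵒᵖ U]

/-- The sequence stays exact under the functor `U ⊗_A -`. -/
def ModSeq.TensorExact (S : ModSeq A) : Prop :=
  ∀ i : ℤ, Function.Exact (btensorMap A B U (S.d i)) (btensorMap A B U (S.d (i + 1)))

/-- The `(B, A)`-bimodule `U` is weakly `C`-compatible, where `C = p(C₁, C₂)`. -/
def IsWeaklyCCompatible (C₁ C₂ : Type u) [AddCommGroup C₁] [Module A C₁] [AddCommGroup C₂]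
    [Module B C₂] : Prop :=
  (∀ S : ModSeq A, S.IsProjAdd C₁ → S.IsExact → S.HomAddExact C₁ → S.TensorExact A B U) ∧
  (∀ S : ModSeq B, S.IsProjAdd C₂ → S.IsExact → S.HomAddExact C₂ →
    ∀ Y : ModuleCat.{u} A, InAdd A C₁ Y → S.HomExact (BTensor A B U Y))

/-- The `(B, A)`-bimodule `U` is weakly compatible: weakly `C`-compatible for
`C = p(A, B) = T` (the regular left `T`-module). -/
def IsWeaklyCompatible : Prop :=
  IsWeaklyCCompatible A B U A B

end Compatible

/-! ### Relative short exact sequences, resolutions and coresolutions -/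

section RelativeExactness

variable {R : Type u} [Ring R]

/-! Cutting a complete sequence into short exact sequences splits $G_C$-projectivity of $M$ into two
independent halves (`isGCProjective_iff`): a $\mathrm{Hom}(-,\mathrm{Add}(C))$-exact projective
resolution, and a coresolution of the same kind by modules in $\mathrm{Add}(C)$. The first half
amounts to $\mathrm{Ext}^n(M,C^{(I)})=0$ for all $n\ge1$ and all $I$ (`hasProjResolution_iff`). The
second is closed under extensions, kernels of epimorphisms (in relative short exact sequences) and
retracts.

A $T$-linear map $\mathbf p(M_1,M_2)\to\mathbf p(N_1,N_2)$ is the same as a triple of maps $M_1\to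
N_1$, $M_2\to U\otimes_A N_1$, $M_2\to N_2$ (`PMod.exists_eq_lift`). If $U$ is weakly
$C$-compatible, then $\mathbf p$ applied termwise to two complete sequences gives a complete
sequence: (a$'$) yields exactness, and (b) controls the middle component of the maps into
$\mathrm{Add}(C)$. By (a$'$) again, its image is $\mathbf p$ of the two images.

For the converse, w-tilting makes every image $Z$ in a complete sequence relatively Gorenstein
projective, not only the one at index $0$ (`ModSeq.isGCProjective_range`). For (a$'$), embed
$\mathbf p(Z,0)$ into a direct sum of copies of $C$; this yields $f:Z\to C_1^{(I)}$ with $U\otimes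
f$ injective. As $f$ extends to the term $X\supseteq Z$ of the sequence, $U\otimes Z\to U\otimes X$
is injective, and right exactness does the rest. For (b), $\mathrm{Ext}^1(\mathbf p(0,Z),\mathbf
p(Y,0))=0$ extends maps into $U\otimes_A Y$, the lower component of $\mathbf p(Y,0)$.

The Gorenstein case takes $C_1=A$ and $C_2=B$: then $C\cong T$ and $\mathrm{Add}$ is the class of
projectives for each of the three rings. -/

theorem LinearMap.exists_comp_eq_of_ker_le {X N F : Type u} [AddCommGroup X] [Module R X]
    [AddCommGroup N] [Module R N] [AddCommGroup F] [Module R F] {p : X →ₗ[R] N}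
    (hp : Function.Surjective p) {f : X →ₗ[R] F} (h : ∀ x, p x = 0 → f x = 0) :
    ∃ g : N →ₗ[R] F, g ∘ₗ p = f := by
  have hle : LinearMap.ker p ≤ LinearMap.ker f := fun x hx => h x hx
  refine ⟨(LinearMap.ker p).liftQ f hle ∘ₗ (p.quotKerEquivOfSurjective hp).symm.toLinearMap, ?_⟩
  ext x
  have : (p.quotKerEquivOfSurjective hp).symm (p x) = (LinearMap.ker p).mkQ x := by
    rw [LinearEquiv.symm_apply_eq]; rfl
  simp [this]

variable (R) in
theorem Module.Projective.finsupp (P : Type u) [AddCommGroup P] [Module R P]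
    [Module.Projective R P] (I : Type u) : Module.Projective R (I →₀ P) := by
  classical
  exact .of_equiv' (finsuppLequivDFinsupp R).symm

variable (R) in
/-- A short exact sequence that stays exact under `Hom_R(-, F)` for all `F` in `Add_R(C)`. -/
structure IsHomSES (C : Type u) [AddCommGroup C] [Module R C] {M X N : Type u} [AddCommGroup M]
    [Module R M] [AddCommGroup X] [Module R X] [AddCommGroup N] [Module R N]
    (j : M →ₗ[R] X) (p : X →ₗ[R] N) : Prop where
  inj : Function.Injective j
  surj : Function.Surjective p
  exact : Function.Exact j p
  ext : ∀ F : ModuleCat.{u} R, InAdd R C F → ∀ f : M →ₗ[R] F, ∃ g : X →ₗ[R] F, g ∘ₗ j = f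

theorem InAdd.of_retract {C X Y : Type u} [AddCommGroup C] [Module R C] [AddCommGroup X]
    [Module R X] [AddCommGroup Y] [Module R Y] (h : InAdd R C X) (s : Y →ₗ[R] X)
    (r : X →ₗ[R] Y) (hrs : r ∘ₗ s = LinearMap.id) : InAdd R C Y := by
  obtain ⟨I, s', r', h'⟩ := h
  refine ⟨I, s' ∘ₗ s, r ∘ₗ r', ?_⟩
  rw [LinearMap.comp_assoc, ← LinearMap.comp_assoc s s' r', h', LinearMap.id_comp, hrs]

theorem InAdd.congr {C X Y : Type u} [AddCommGroup C] [Module R C] [AddCommGroup X]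
    [Module R X] [AddCommGroup Y] [Module R Y] (h : InAdd R C X) (e : X ≃ₗ[R] Y) :
    InAdd R C Y :=
  h.of_retract e.symm.toLinearMap e.toLinearMap (by ext; simp)

theorem InAdd.finsupp_self (C : Type u) [AddCommGroup C] [Module R C] (I : Type u) :
    InAdd R C (I →₀ C) :=
  ⟨I, LinearMap.id, LinearMap.id, rfl⟩

theorem InAdd.congr_left {C D X : Type u} [AddCommGroup C] [Module R C] [AddCommGroup D]
    [Module R D] [AddCommGroup X] [Module R X] (h : InAdd R C X) (e : C ≃ₗ[R] D) :
    InAdd R D X := by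
  obtain ⟨I, s, r, h⟩ := h
  exact (InAdd.finsupp_self D I).of_retract ((Finsupp.mapRange.linearEquiv e).toLinearMap ∘ₗ s)
    (r ∘ₗ (Finsupp.mapRange.linearEquiv e).symm.toLinearMap) (by
      ext x
      change r ((Finsupp.mapRange.linearEquiv e).symm (Finsupp.mapRange.linearEquiv e (s x))) = x
      rw [LinearEquiv.symm_apply_apply]
      exact LinearMap.congr_fun h x)

theorem InAdd.finsupp {C X : Type u} [AddCommGroup C] [Module R C] [AddCommGroup X]
    [Module R X] (h : InAdd R C X) (J : Type u) : InAdd R C (J →₀ X) := by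
  obtain ⟨I, s, r, h⟩ := h
  refine ((InAdd.finsupp_self C (J × I)).congr (Finsupp.curryLinearEquiv R)).of_retract
    (Finsupp.mapRange.linearMap s) (Finsupp.mapRange.linearMap r) ?_
  rw [← Finsupp.mapRange.linearMap_comp, h, Finsupp.mapRange.linearMap_id]

theorem InAdd.prod {C X Y : Type u} [AddCommGroup C] [Module R C] [AddCommGroup X]
    [Module R X] [AddCommGroup Y] [Module R Y] (hX : InAdd R C X) (hY : InAdd R C Y) :
    InAdd R C (X × Y) := by
  obtain ⟨I, s, r, h⟩ := hX
  obtain ⟨J, s', r', h'⟩ := hY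
  refine ((InAdd.finsupp_self C (I ⊕ J)).congr (Finsupp.sumFinsuppLEquivProdFinsupp R)).of_retract
    (s.prodMap s') (r.prodMap r') ?_
  ext x <;> simp [show ∀ x, r (s x) = x from LinearMap.congr_fun h,
    show ∀ x, r' (s' x) = x from LinearMap.congr_fun h']

theorem InAdd.of_subsingleton (C X : Type u) [AddCommGroup C] [Module R C] [AddCommGroup X]
    [Module R X] [Subsingleton X] : InAdd R C X :=
  ⟨PUnit, 0, 0, LinearMap.ext fun _ => Subsingleton.elim _ _⟩

theorem InAdd.projective {C X : Type u} [AddCommGroup C] [Module R C] [AddCommGroup X]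
    [Module R X] [Module.Projective R C] (h : InAdd R C X) : Module.Projective R X := by
  obtain ⟨I, s, r, h⟩ := h
  have := Module.Projective.finsupp R C I
  exact .of_split s r h

theorem inAdd_self_iff (X : Type u) [AddCommGroup X] [Module R X] :
    InAdd R R X ↔ Module.Projective R X :=
  ⟨fun h => h.projective, fun ⟨s, hs⟩ =>
    ⟨X, s, Finsupp.linearCombination R id, LinearMap.ext hs⟩⟩

/-- It suffices to test `Hom_R(-, Add_R(C))`-exactness on the direct sums `C^(I)`. -/
theorem IsHomSES.of_finsupp {C M X N : Type u} [AddCommGroup C] [Module R C] [AddCommGroup M]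
    [Module R M] [AddCommGroup X] [Module R X] [AddCommGroup N] [Module R N]
    {j : M →ₗ[R] X} {p : X →ₗ[R] N} (hj : Function.Injective j) (hp : Function.Surjective p)
    (hjp : Function.Exact j p)
    (h : ∀ (I : Type u) (f : M →ₗ[R] (I →₀ C)), ∃ g : X →ₗ[R] (I →₀ C), g ∘ₗ j = f) :
    IsHomSES R C j p := by
  refine ⟨hj, hp, hjp, ?_⟩
  rintro F ⟨I, s, r, hrs⟩ f
  obtain ⟨g, hg⟩ := h I (s ∘ₗ f)
  refine ⟨r ∘ₗ g, ?_⟩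
  rw [LinearMap.comp_assoc, hg, ← LinearMap.comp_assoc, hrs, LinearMap.id_comp]

theorem IsHomSES.of_split {C M X N : Type u} [AddCommGroup C] [Module R C] [AddCommGroup M]
    [Module R M] [AddCommGroup X] [Module R X] [AddCommGroup N] [Module R N]
    {j : M →ₗ[R] X} {p : X →ₗ[R] N} (q : X →ₗ[R] M) (hq : q ∘ₗ j = LinearMap.id)
    (hp : Function.Surjective p) (hjp : Function.Exact j p) : IsHomSES R C j p :=
  ⟨Function.LeftInverse.injective (g := q) (LinearMap.congr_fun hq), hp, hjp,
    fun _ _ f => ⟨f ∘ₗ q, by rw [LinearMap.comp_assoc, hq, LinearMap.comp_id]⟩⟩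

theorem IsHomSES.finsupp {C M X N : Type u} [AddCommGroup C] [Module R C] [AddCommGroup M]
    [Module R M] [AddCommGroup X] [Module R X] [AddCommGroup N] [Module R N]
    {j : M →ₗ[R] X} {p : X →ₗ[R] N} (h : IsHomSES R C j p) (I : Type u) :
    IsHomSES R C (Finsupp.mapRange.linearMap j : (I →₀ M) →ₗ[R] (I →₀ X))
      (Finsupp.mapRange.linearMap p) := by
  refine ⟨Finsupp.mapRange_injective _ (map_zero j) h.inj,
    Finsupp.mapRange_surjective _ (map_zero p) h.surj, ?_, ?_⟩
  · intro x
    constructor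
    · intro hx
      have hx' : ∀ i, ∃ y, j y = x i := fun i =>
        (h.exact (x i)).1 (by simpa using DFunLike.congr_fun hx i)
      choose y hy using hx'
      refine ⟨Finsupp.onFinset x.support y fun i hi => ?_, ?_⟩
      · rw [Finsupp.mem_support_iff, ← hy]
        exact fun h0 => hi (h.inj (h0.trans (map_zero j).symm))
      · ext i; simp [hy]
    · rintro ⟨y, rfl⟩
      ext i
      simpa using h.exact.apply_apply_eq_zero (y i)
  · intro F hF f
    have h' : ∀ i, ∃ g : X →ₗ[R] F, g ∘ₗ j = f ∘ₗ Finsupp.lsingle i := fun i => h.ext F hF _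
    choose g hg using h'
    refine ⟨Finsupp.lsum ℕ g, ?_⟩
    ext i m
    simpa using LinearMap.congr_fun (hg i) m

variable (R) in
/-- `M` has a `Hom_R(-, Add_R(C))`-exact coresolution by modules in `Add_R(C)`. -/
def HasAddCoresolution (C : Type u) [AddCommGroup C] [Module R C] (M : ModuleCat.{u} R) : Prop :=
  ∃ P : ModuleCat.{u} R → Prop, P M ∧ ∀ N, P N → ∃ (D N' : ModuleCat.{u} R) (j : N →ₗ[R] D)
    (p : D →ₗ[R] N'), InAdd R C D ∧ P N' ∧ IsHomSES R C j p

variable (R) in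
/-- `M` has a `Hom_R(-, Add_R(C))`-exact resolution by projective modules. -/
def HasProjResolution (C : Type u) [AddCommGroup C] [Module R C] (M : ModuleCat.{u} R) : Prop :=
  ∃ P : ModuleCat.{u} R → Prop, P M ∧ ∀ N, P N → ∃ (K Q : ModuleCat.{u} R) (j : K →ₗ[R] Q)
    (p : Q →ₗ[R] N), Module.Projective R Q ∧ P K ∧ IsHomSES R C j p

variable {C : Type u} [AddCommGroup C] [Module R C]

/-- A coresolution is encoded coinductively, as a class of modules each of whose members admits one
step staying in the class. Existence proofs exhibit such an invariant class instead of an infinite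
sequence; this lemma unfolds one step. `HasProjResolution` works the same way. -/
theorem HasAddCoresolution.step {M : ModuleCat.{u} R} (h : HasAddCoresolution R C M) :
    ∃ (D M' : ModuleCat.{u} R) (j : M →ₗ[R] D) (p : D →ₗ[R] M'), InAdd R C D ∧
      HasAddCoresolution R C M' ∧ IsHomSES R C j p := by
  obtain ⟨P, hM, hP⟩ := h
  obtain ⟨D, M', j, p, hD, hM', hs⟩ := hP M hM
  exact ⟨D, M', j, p, hD, ⟨P, hM', hP⟩, hs⟩

theorem HasProjResolution.step {M : ModuleCat.{u} R} (h : HasProjResolution R C M) :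
    ∃ (K Q : ModuleCat.{u} R) (j : K →ₗ[R] Q) (p : Q →ₗ[R] M), Module.Projective R Q ∧
      HasProjResolution R C K ∧ IsHomSES R C j p := by
  obtain ⟨P, hM, hP⟩ := h
  obtain ⟨D, M', j, p, hD, hM', hs⟩ := hP M hM
  exact ⟨D, M', j, p, hD, ⟨P, hM', hP⟩, hs⟩

/-- The class of modules with a coresolution is closed under extensions. -/
theorem HasAddCoresolution.of_extension {M N L : ModuleCat.{u} R} {i : M →ₗ[R] N}
    {q : N →ₗ[R] L} (hs : IsHomSES R C i q) (hM : HasAddCoresolution R C M)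
    (hL : HasAddCoresolution R C L) : HasAddCoresolution R C N := by
  refine ⟨fun N => ∃ (M L : ModuleCat.{u} R) (i : M →ₗ[R] N) (q : N →ₗ[R] L),
    IsHomSES R C i q ∧ HasAddCoresolution R C M ∧ HasAddCoresolution R C L,
    ⟨M, L, i, q, hs, hM, hL⟩, ?_⟩
  clear hs hM hL i q M N L
  rintro N ⟨M, L, i, q, hs, hM, hL⟩
  obtain ⟨D, M', j, p, hD, hM', hD'⟩ := hM.step
  obtain ⟨E, L', k, r, hE, hL', hE'⟩ := hL.step
  -- Horseshoe lemma: relative exactness extends `j` to `δ` on `N`, so `(δ, k ∘ q)` embeds `N` into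
  -- `D × E`. The cokernel is again an extension of `L'` by `M'`, which keeps the class invariant.
  obtain ⟨δ, hδ⟩ := hs.ext D hD j
  replace hδ : ∀ m, δ (i m) = j m := fun m => LinearMap.congr_fun hδ m
  let v : N →ₗ[R] D × E := δ.prod (k ∘ₗ q)
  let W : Submodule R (D × E) := LinearMap.range v
  have hv : Function.Injective v := by
    rw [injective_iff_map_eq_zero]
    intro n hn
    have h1 : δ n = 0 := congrArg Prod.fst hn
    have h2 : k (q n) = 0 := congrArg Prod.snd hn
    have h3 : q n = 0 := hE'.inj (h2.trans (map_zero k).symm)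
    obtain ⟨m, rfl⟩ := (hs.exact n).1 h3
    rw [hδ] at h1
    rw [hD'.inj (h1.trans (map_zero j).symm), map_zero]
  obtain ⟨a, ha⟩ := LinearMap.exists_comp_eq_of_ker_le (f := W.mkQ ∘ₗ LinearMap.inl R D E)
    hD'.surj (by
      intro d hd
      obtain ⟨m, rfl⟩ := (hD'.exact d).1 hd
      refine (Submodule.Quotient.mk_eq_zero W).2 ⟨i m, ?_⟩
      simp [v, hδ, hs.exact.apply_apply_eq_zero])
  replace ha : ∀ d, a (p d) = W.mkQ (d, 0) := fun d => LinearMap.congr_fun ha d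
  let b : ((D × E) ⧸ W) →ₗ[R] L' := W.liftQ (r ∘ₗ LinearMap.snd R D E) (by
    rintro _ ⟨n, rfl⟩
    simp [v, hE'.exact.apply_apply_eq_zero])
  have hb : ∀ x, b (W.mkQ x) = r x.2 := fun x => rfl
  refine ⟨ModuleCat.of R (D × E), ModuleCat.of R ((D × E) ⧸ W), v, W.mkQ, hD.prod hE,
    ⟨M', L', a, b, ⟨?_, ?_, ?_, ?_⟩, hM', hL'⟩, ⟨hv, W.mkQ_surjective, ?_, ?_⟩⟩
  · rw [injective_iff_map_eq_zero]
    intro m' hm'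
    obtain ⟨d, rfl⟩ := hD'.surj m'
    rw [ha] at hm'
    obtain ⟨n, hn⟩ := (Submodule.Quotient.mk_eq_zero W).1 hm'
    have h1 : δ n = d := congrArg Prod.fst hn
    have h2 : k (q n) = 0 := congrArg Prod.snd hn
    obtain ⟨m, rfl⟩ := (hs.exact n).1 (hE'.inj (h2.trans (map_zero k).symm))
    rw [← h1, hδ, hD'.exact.apply_apply_eq_zero]
  · intro l
    obtain ⟨e, rfl⟩ := hE'.surj l
    exact ⟨W.mkQ (0, e), rfl⟩
  · intro x
    obtain ⟨⟨d, e⟩, rfl⟩ := W.mkQ_surjective x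
    constructor
    · intro hx
      obtain ⟨l, rfl⟩ := (hE'.exact e).1 hx
      obtain ⟨n, rfl⟩ := hs.surj l
      refine ⟨p (d - δ n), ?_⟩
      rw [ha]
      refine (Submodule.Quotient.eq W).2 ⟨-n, ?_⟩
      simp [v]
    · rintro ⟨m', hm'⟩
      obtain ⟨d', rfl⟩ := hD'.surj m'
      rw [← hm', ha, hb, map_zero]
  · intro F hF f
    -- On `D` the extension must be `f ∘ p`. Its restriction to `N` through `δ` kills `M`, hence
    -- comes from `L`; the extension `g'` of that map to `E` is subtracted to make the total vanish
    -- on `W`.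
    obtain ⟨g, hg⟩ := LinearMap.exists_comp_eq_of_ker_le (f := f ∘ₗ p ∘ₗ δ) hs.surj (by
      intro n hn
      obtain ⟨m, rfl⟩ := (hs.exact n).1 hn
      simp [hδ, hD'.exact.apply_apply_eq_zero])
    obtain ⟨g', hg'⟩ := hE'.ext F hF g
    refine ⟨W.liftQ ((f ∘ₗ p).coprod (-g')) ?_, ?_⟩
    · rintro _ ⟨n, rfl⟩
      have h1 : g (q n) = f (p (δ n)) := LinearMap.congr_fun hg n
      have h2 : g' (k (q n)) = g (q n) := LinearMap.congr_fun hg' (q n)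
      simp [v, h1, h2]
    · ext m'
      obtain ⟨d, rfl⟩ := hD'.surj m'
      simp [ha]
  · intro x
    exact Submodule.Quotient.mk_eq_zero W
  · intro F hF f
    obtain ⟨g, hg⟩ := hD'.ext F hF (f ∘ₗ i)
    obtain ⟨h, hh⟩ := LinearMap.exists_comp_eq_of_ker_le (f := f - g ∘ₗ δ) hs.surj (by
      intro n hn
      obtain ⟨m, rfl⟩ := (hs.exact n).1 hn
      have h1 : g (j m) = f (i m) := LinearMap.congr_fun hg m
      simp [hδ, h1])
    obtain ⟨h', hh'⟩ := hE'.ext F hF h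
    refine ⟨g.coprod h', ?_⟩
    ext n
    have h1 : h (q n) = f n - g (δ n) := LinearMap.congr_fun hh n
    have h2 : h' (k (q n)) = h (q n) := LinearMap.congr_fun hh' (q n)
    change g (δ n) + h' (k (q n)) = f n
    rw [h2, h1]; abel

/-- The class of modules with a coresolution is closed under kernels of epimorphisms. -/
theorem HasAddCoresolution.of_kernel {M X N : ModuleCat.{u} R} {i : M →ₗ[R] X}
    {q : X →ₗ[R] N} (hs : IsHomSES R C i q) (hX : HasAddCoresolution R C X)
    (hN : HasAddCoresolution R C N) : HasAddCoresolution R C M := by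
  obtain ⟨D, X', j, p, hD, hX', hD'⟩ := hX.step
  -- With `M ⊆ X ⊆ D`, the quotient `D/M` is an extension of `D/X = X'` by `X/M = N`, so it has a
  -- coresolution; prefixing `D` gives one for `M`.
  let W : Submodule R D := LinearMap.range (j ∘ₗ i)
  obtain ⟨a, ha⟩ := LinearMap.exists_comp_eq_of_ker_le (f := W.mkQ ∘ₗ j) hs.surj (by
    intro x hx
    obtain ⟨m, rfl⟩ := (hs.exact x).1 hx
    exact (Submodule.Quotient.mk_eq_zero W).2 ⟨m, rfl⟩)
  replace ha : ∀ x, a (q x) = W.mkQ (j x) := fun x => LinearMap.congr_fun ha x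
  let b : (D ⧸ W) →ₗ[R] X' := W.liftQ p (by
    rintro _ ⟨m, rfl⟩
    simp [hD'.exact.apply_apply_eq_zero])
  have hb : ∀ x, b (W.mkQ x) = p x := fun x => rfl
  have hDW : HasAddCoresolution R C (ModuleCat.of R (D ⧸ W)) := by
    refine HasAddCoresolution.of_extension (i := a) (q := b) ⟨?_, ?_, ?_, ?_⟩ hN hX'
    · rw [injective_iff_map_eq_zero]
      intro n hn
      obtain ⟨x, rfl⟩ := hs.surj n
      rw [ha] at hn
      obtain ⟨m, hm⟩ := (Submodule.Quotient.mk_eq_zero W).1 hn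
      rw [← hD'.inj hm, hs.exact.apply_apply_eq_zero]
    · intro x
      obtain ⟨d, rfl⟩ := hD'.surj x
      exact ⟨W.mkQ d, rfl⟩
    · intro x
      obtain ⟨d, rfl⟩ := W.mkQ_surjective x
      constructor
      · intro hx
        obtain ⟨y, rfl⟩ := (hD'.exact d).1 hx
        exact ⟨q y, ha y⟩
      · rintro ⟨n, hn⟩
        obtain ⟨y, rfl⟩ := hs.surj n
        rw [← hn, ha, hb, hD'.exact.apply_apply_eq_zero]
    · intro F hF f
      obtain ⟨g, hg⟩ := hD'.ext F hF (f ∘ₗ q)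
      replace hg : ∀ x, g (j x) = f (q x) := fun x => LinearMap.congr_fun hg x
      refine ⟨W.liftQ g ?_, ?_⟩
      · rintro _ ⟨m, rfl⟩
        simp [hg, hs.exact.apply_apply_eq_zero]
      · ext n
        obtain ⟨x, rfl⟩ := hs.surj n
        simp [ha, hg]
  obtain ⟨P, hP, hP'⟩ := hDW
  refine ⟨fun K => K = M ∨ P K, Or.inl rfl, ?_⟩
  rintro K (rfl | hK)
  · refine ⟨D, ModuleCat.of R (D ⧸ W), j ∘ₗ i, W.mkQ, hD, Or.inr hP,
      hD'.inj.comp hs.inj, W.mkQ_surjective, fun x => Submodule.Quotient.mk_eq_zero W, ?_⟩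
    intro F hF f
    obtain ⟨g, hg⟩ := hs.ext F hF f
    obtain ⟨h, hh⟩ := hD'.ext F hF g
    exact ⟨h, by rw [← LinearMap.comp_assoc, hh, hg]⟩
  · obtain ⟨D, N', j, p, hD, hN', h⟩ := hP' K hK
    exact ⟨D, N', j, p, hD, Or.inr hN', h⟩

theorem HasAddCoresolution.finsupp {M : ModuleCat.{u} R} (hM : HasAddCoresolution R C M)
    (I : Type u) : HasAddCoresolution R C (ModuleCat.of R (I →₀ M)) := by
  refine ⟨fun N => ∃ K : ModuleCat.{u} R, HasAddCoresolution R C K ∧ N = ModuleCat.of R (I →₀ K),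
    ⟨M, hM, rfl⟩, ?_⟩
  rintro _ ⟨K, hK, rfl⟩
  obtain ⟨D, K', j, p, hD, hK', h⟩ := hK.step
  exact ⟨ModuleCat.of R (I →₀ D), ModuleCat.of R (I →₀ K'), Finsupp.mapRange.linearMap j,
    Finsupp.mapRange.linearMap p, hD.finsupp I, ⟨K', hK', rfl⟩, h.finsupp I⟩

theorem HasProjResolution.finsupp {M : ModuleCat.{u} R} (hM : HasProjResolution R C M)
    (I : Type u) : HasProjResolution R C (ModuleCat.of R (I →₀ M)) := by
  refine ⟨fun N => ∃ K : ModuleCat.{u} R, HasProjResolution R C K ∧ N = ModuleCat.of R (I →₀ K),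
    ⟨M, hM, rfl⟩, ?_⟩
  rintro _ ⟨K, hK, rfl⟩
  obtain ⟨K', Q, j, p, hD, hK', h⟩ := hK.step
  exact ⟨ModuleCat.of R (I →₀ K'), ModuleCat.of R (I →₀ Q), Finsupp.mapRange.linearMap j,
    Finsupp.mapRange.linearMap p, Module.Projective.finsupp R Q I,
    ⟨K', hK', rfl⟩, h.finsupp I⟩

/-- A retract `X` of `W` is the kernel of a split epimorphism `W^(ℕ) → W^(ℕ)`. -/
theorem HasAddCoresolution.of_retract {W X : ModuleCat.{u} R} (hW : HasAddCoresolution R C W)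
    (s : X →ₗ[R] W) (r : W →ₗ[R] X) (hrs : r ∘ₗ s = LinearMap.id) :
    HasAddCoresolution R C X := by
  have hW' := hW.finsupp (ULift.{u} ℕ)
  have hrs' : ∀ x, r (s x) = x := LinearMap.congr_fun hrs
  let σ : ULift.{u} ℕ → ULift.{u} ℕ := fun n => ⟨n.down + 1⟩
  have hσ : Function.Injective σ := fun m n h => by
    have : m.down + 1 = n.down + 1 := congrArg ULift.down h
    exact ULift.ext _ _ (by omega)
  let e : W →ₗ[R] W := s ∘ₗ r
  have he : ∀ w, e (e w) = e w := fun w => by simp [e, hrs']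
  -- Eilenberg swindle: `φ` fixes the `(1 - e)`-part of every coordinate and shifts the `e`-part one
  -- place to the left. Its kernel is the `e`-part of coordinate `0`, a copy of `X`.
  let φ : (ULift.{u} ℕ →₀ W) →ₗ[R] (ULift.{u} ℕ →₀ W) :=
    Finsupp.mapRange.linearMap (LinearMap.id - e) +
      Finsupp.mapRange.linearMap e ∘ₗ Finsupp.lcomapDomain σ hσ
  have hφ : ∀ w n, φ w n = w n - e (w n) + e (w (σ n)) := fun w n => by
    simp [φ, Finsupp.lcomapDomain]
  refine HasAddCoresolution.of_kernel (i := Finsupp.lsingle ⟨0⟩ ∘ₗ s) (q := φ)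
    (IsHomSES.of_split (r ∘ₗ Finsupp.lapply ⟨0⟩) ?_ ?_ ?_) hW' hW'
  · ext x; simp [hrs']
  · intro v
    -- The preimage keeps the `(1 - e)`-part and shifts the `e`-part one place to the right.
    refine ⟨Finsupp.mapRange.linearMap (LinearMap.id - e) v +
      Finsupp.lmapDomain W R σ (Finsupp.mapRange.linearMap e v), ?_⟩
    have h1 : ∀ n, Finsupp.lmapDomain W R σ (Finsupp.mapRange.linearMap e v) (σ n) = e (v n) := by
      intro n
      simp [Finsupp.lmapDomain, Finsupp.mapDomain_apply hσ]
    have h2 : ∀ n, e (Finsupp.lmapDomain W R σ (Finsupp.mapRange.linearMap e v) n) =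
        Finsupp.lmapDomain W R σ (Finsupp.mapRange.linearMap e v) n := by
      rintro ⟨_ | n⟩
      · have : Finsupp.lmapDomain W R σ (Finsupp.mapRange.linearMap e v) ⟨0⟩ = 0 := by
          refine Finsupp.mapDomain_of_notMem_range _ _ ?_
          rintro ⟨n, hn⟩
          exact Nat.succ_ne_zero _ (congrArg ULift.down hn)
        rw [this, map_zero]
      · exact (h1 ⟨n⟩).symm ▸ he _
    ext n
    rw [hφ, Finsupp.add_apply, Finsupp.add_apply, map_add, map_add, h1, h2, he]
    simp [he]
  · intro w
    constructor
    · intro hw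
      have h1 : ∀ n, w n - e (w n) + e (w (σ n)) = 0 := fun n => by rw [← hφ, hw]; rfl
      have h2 : ∀ n, e (w (σ n)) = 0 := fun n => by
        have := congrArg e (h1 n)
        simpa [he] using this
      have h3 : ∀ n, w n = e (w n) := fun n => by
        have := h1 n
        rwa [h2, add_zero, sub_eq_zero] at this
      refine ⟨r (w ⟨0⟩), ?_⟩
      ext n
      obtain ⟨_ | n⟩ := n
      · simpa [e] using (h3 ⟨0⟩).symm
      · have : w (σ ⟨n⟩) = 0 := (h3 _).trans (h2 ⟨n⟩)
        have hne : (⟨0⟩ : ULift.{u} ℕ) ≠ σ ⟨n⟩ := fun h =>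
          Nat.succ_ne_zero _ (congrArg ULift.down h).symm
        change (Finsupp.single (⟨0⟩ : ULift.{u} ℕ) (s (r (w ⟨0⟩)))) (σ ⟨n⟩) = w (σ ⟨n⟩)
        rw [Finsupp.single_eq_of_ne hne.symm, this]
    · rintro ⟨x, rfl⟩
      ext n
      rw [hφ]
      have hne : (⟨0⟩ : ULift.{u} ℕ) ≠ σ n := fun h =>
        Nat.succ_ne_zero _ (congrArg ULift.down h).symm
      by_cases hn : (⟨0⟩ : ULift.{u} ℕ) = n
      · subst hn
        simp [Finsupp.single_eq_of_ne hne.symm, e, hrs']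
      · simp [Finsupp.single_eq_of_ne hne.symm, Finsupp.single_eq_of_ne (Ne.symm hn)]

end RelativeExactness

/-! ### Complete sequences: decomposition and splicing -/

section CompleteSequences

variable {R : Type u} [Ring R]

/-- A sequence obtained by splicing short exact sequences `0 → Z i → X (i + 1) → Z (i + 1) → 0`. -/
theorem isGCProjective_of_splice {C : Type u} [AddCommGroup C] [Module R C]
    (Z X : ℤ → ModuleCat.{u} R) (p : ∀ i, X i →ₗ[R] Z i) (j : ∀ i, Z i →ₗ[R] X (i + 1))
    (hX : ∀ i, i ≤ 0 → Module.Projective R (X i)) (hX' : ∀ i, 0 < i → InAdd R C (X i))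
    (h : ∀ i, IsHomSES R C (j i) (p (i + 1))) : IsGCProjective R C (Z 0) := by
  have hp : ∀ i, Function.Surjective (p i) := fun i => by
    obtain ⟨k, rfl⟩ : ∃ k, i = k + 1 := ⟨i - 1, by omega⟩
    exact (h k).surj
  refine ⟨⟨X, fun i => j i ∘ₗ p i⟩, ⟨hX, hX'⟩, fun i x => ?_, fun F hF i f => ?_, ?_⟩
  · constructor
    · intro hx
      have h0 : p (i + 1) x = 0 := (h (i + 1)).inj (Eq.trans hx (map_zero _).symm)
      obtain ⟨z, rfl⟩ := ((h i).exact x).1 h0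
      obtain ⟨y, rfl⟩ := hp i z
      exact ⟨y, rfl⟩
    · rintro ⟨y, rfl⟩
      simp [(h i).exact.apply_apply_eq_zero]
  · constructor
    · intro hf
      replace hf : f ∘ₗ j i ∘ₗ p i = 0 := hf
      obtain ⟨g, hg⟩ := LinearMap.exists_comp_eq_of_ker_le (f := f) (hp (i + 1)) (by
        intro x hx
        obtain ⟨z, rfl⟩ := ((h i).exact x).1 hx
        obtain ⟨y, rfl⟩ := hp i z
        exact LinearMap.congr_fun hf y)
      obtain ⟨g', hg'⟩ := (h (i + 1)).ext F hF g
      exact ⟨g', by change g' ∘ₗ j (i + 1) ∘ₗ p (i + 1) = f; rw [← LinearMap.comp_assoc, hg', hg]⟩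
    · rintro ⟨g, rfl⟩
      ext y
      simp [(h i).exact.apply_apply_eq_zero]
  · have : LinearMap.range (j 0 ∘ₗ p 0) = LinearMap.range (j 0) :=
      LinearMap.range_comp_of_range_eq_top _ (LinearMap.range_eq_top.2 (hp 0))
    exact ⟨(LinearEquiv.ofInjective (j 0) (h 0).inj).trans (LinearEquiv.ofEq _ _ this.symm)⟩

/-- The short exact sequences into which a complete sequence decomposes. -/
theorem ModSeq.isHomSES {C : Type u} [AddCommGroup C] [Module R C] {S : ModSeq R}
    (hS : S.IsExact) (hC : S.HomAddExact C) (i : ℤ) :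
    IsHomSES R C (LinearMap.range (S.d i)).subtype (S.d (i + 1)).rangeRestrict := by
  refine ⟨Subtype.val_injective, LinearMap.surjective_rangeRestrict _, fun x => ?_,
    fun F hF f => ?_⟩
  · refine Iff.trans ?_ ((hS i x).trans ?_)
    · exact Subtype.ext_iff
    · exact ⟨fun h => ⟨⟨x, h⟩, rfl⟩, fun ⟨y, hy⟩ => hy ▸ y.2⟩
  · obtain ⟨k, rfl⟩ : ∃ k, i = k + 1 := ⟨i - 1, by omega⟩
    -- Pulled back to the term before the image, `f` is a cocycle, hence a coboundary; the cochain
    -- bounding it is the extension.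
    obtain ⟨g, hg⟩ := (hC F hF k (f ∘ₗ (S.d (k + 1)).rangeRestrict)).1 (by
      ext x
      have : (S.d (k + 1)).rangeRestrict (S.d k x) = 0 :=
        Subtype.ext ((hS k).apply_apply_eq_zero x)
      simp [this])
    refine ⟨g, ?_⟩
    ext ⟨_, x, rfl⟩
    exact LinearMap.congr_fun hg x

variable {C : Type u} [AddCommGroup C] [Module R C]

theorem IsHomSES.congr_right {M X N N' : Type u} [AddCommGroup M]
    [Module R M] [AddCommGroup X] [Module R X] [AddCommGroup N] [Module R N]
    [AddCommGroup N'] [Module R N'] {j : M →ₗ[R] X} {p : X →ₗ[R] N} (h : IsHomSES R C j p)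
    (e : N ≃ₗ[R] N') : IsHomSES R C j (e.toLinearMap ∘ₗ p) :=
  ⟨h.inj, e.surjective.comp h.surj, fun x => by simpa using h.exact x, h.ext⟩

theorem IsHomSES.congr_left {M M' X N : Type u} [AddCommGroup M]
    [Module R M] [AddCommGroup X] [Module R X] [AddCommGroup N] [Module R N]
    [AddCommGroup M'] [Module R M'] {j : M →ₗ[R] X} {p : X →ₗ[R] N} (h : IsHomSES R C j p)
    (e : M' ≃ₗ[R] M) : IsHomSES R C (j ∘ₗ e.toLinearMap) p := by
  refine ⟨h.inj.comp e.injective, h.surj, fun x => ?_, fun F hF f => ?_⟩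
  · rw [h.exact x]
    exact ⟨fun ⟨y, hy⟩ => ⟨e.symm y, by simpa using hy⟩, fun ⟨y, hy⟩ => ⟨e y, hy⟩⟩
  · obtain ⟨g, hg⟩ := h.ext F hF (f ∘ₗ e.symm.toLinearMap)
    exact ⟨g, by rw [← LinearMap.comp_assoc, hg]; ext; simp⟩

theorem ModSeq.hasProjResolution {S : ModSeq R} (hP : S.IsProjAdd C) (hS : S.IsExact)
    (hC : S.HomAddExact C) {i : ℤ} (hi : i ≤ 0) {M : ModuleCat.{u} R}
    (e : M ≃ₗ[R] LinearMap.range (S.d i)) : HasProjResolution R C M := by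
  refine ⟨fun N => ∃ i : ℤ, i ≤ 0 ∧ Nonempty (N ≃ₗ[R] LinearMap.range (S.d i)),
    ⟨i, hi, ⟨e⟩⟩, ?_⟩
  rintro N ⟨i, hi, ⟨e⟩⟩
  obtain ⟨k, rfl⟩ : ∃ k, i = k + 1 := ⟨i - 1, by omega⟩
  exact ⟨ModuleCat.of R (LinearMap.range (S.d k)), S.X (k + 1), _, _, hP.1 _ hi,
    ⟨k, by omega, ⟨LinearEquiv.refl R _⟩⟩, (ModSeq.isHomSES hS hC k).congr_right e.symm⟩

theorem ModSeq.hasAddCoresolution {S : ModSeq R} (hP : ∀ i : ℤ, 0 < i → InAdd R C (S.X i))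
    (hS : S.IsExact) (hC : S.HomAddExact C) {i : ℤ} (hi : 0 ≤ i) {M : ModuleCat.{u} R}
    (e : M ≃ₗ[R] LinearMap.range (S.d i)) : HasAddCoresolution R C M := by
  refine ⟨fun N => ∃ i : ℤ, 0 ≤ i ∧ Nonempty (N ≃ₗ[R] LinearMap.range (S.d i)),
    ⟨i, hi, ⟨e⟩⟩, ?_⟩
  rintro N ⟨i, hi, ⟨e⟩⟩
  exact ⟨S.X (i + 1), ModuleCat.of R (LinearMap.range (S.d (i + 1))), _, _, hP _ (by omega),
    ⟨i + 1, by omega, ⟨LinearEquiv.refl R _⟩⟩, (ModSeq.isHomSES hS hC i).congr_left e⟩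

/-- `M` is `G_C`-projective if and only if it has both a relative projective resolution and a
relative coresolution by modules in `Add_R(C)`. -/
theorem isGCProjective_iff (M : ModuleCat.{u} R) :
    IsGCProjective R C M ↔ HasProjResolution R C M ∧ HasAddCoresolution R C M := by
  constructor
  · rintro ⟨S, h1, h2, h3, ⟨e⟩⟩
    exact ⟨ModSeq.hasProjResolution h1 h2 h3 le_rfl e,
      ModSeq.hasAddCoresolution h1.2 h2 h3 le_rfl e⟩
  · rintro ⟨hL, hR⟩
    have stepR : ∀ N : {N : ModuleCat.{u} R // HasAddCoresolution R C N},
        ∃ N' : {N : ModuleCat.{u} R // HasAddCoresolution R C N}, ∃ (D : ModuleCat.{u} R)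
          (j : N.1 →ₗ[R] D) (p : D →ₗ[R] N'.1), InAdd R C D ∧ IsHomSES R C j p := by
      rintro ⟨N, hN⟩
      obtain ⟨D, N', j, p, hD, hN', h⟩ := hN.step
      exact ⟨⟨N', hN'⟩, D, j, p, hD, h⟩
    have stepL : ∀ N : {N : ModuleCat.{u} R // HasProjResolution R C N},
        ∃ K : {N : ModuleCat.{u} R // HasProjResolution R C N}, ∃ (Q : ModuleCat.{u} R)
          (j : K.1 →ₗ[R] Q) (p : Q →ₗ[R] N.1), Module.Projective R Q ∧ IsHomSES R C j p := by
      rintro ⟨N, hN⟩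
      obtain ⟨K, Q, j, p, hD, hN', h⟩ := hN.step
      exact ⟨⟨K, hN'⟩, Q, j, p, hD, h⟩
    choose sR hsR using stepR
    choose sL hsL using stepL
    let ZR : ℕ → {N : ModuleCat.{u} R // HasAddCoresolution R C N} :=
      fun n => Nat.rec ⟨M, hR⟩ (fun _ => sR) n
    let ZL : ℕ → {N : ModuleCat.{u} R // HasProjResolution R C N} :=
      fun n => Nat.rec ⟨M, hL⟩ (fun _ => sL) n
    -- `M` has index `0`, with its cosyzygies to the right and its syzygies to the left.
    let Z : ℤ → ModuleCat.{u} R := fun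
      | .ofNat n => (ZR n).1
      | .negSucc n => (ZL (n + 1)).1
    have key : ∀ i k : ℤ, k = i + 1 → ∃ (X : ModuleCat.{u} R) (j : Z i →ₗ[R] X)
        (p : X →ₗ[R] Z k), (i < 0 → Module.Projective R X) ∧ (0 ≤ i → InAdd R C X) ∧
          IsHomSES R C j p := by
      rintro (n | n | n) _ rfl
      · obtain ⟨D, j, p, hD, h⟩ := hsR (ZR n)
        exact ⟨D, j, p, fun h => absurd h (by simp), fun _ => hD, h⟩
      · obtain ⟨D, j, p, hD, h⟩ := hsL (ZL 0)
        exact ⟨D, j, p, fun _ => hD, fun h => absurd h (by simp), h⟩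
      · obtain ⟨D, j, p, hD, h⟩ := hsL (ZL (n + 1))
        exact ⟨D, j, p, fun _ => hD, fun h => absurd h (by simp), h⟩
    -- The middle term is indexed by its quotient `Z k`, and its submodule by any `i` with `k = i +
    -- 1`; this avoids transport along `k - 1 + 1 = k` when splicing.
    have key' : ∀ k : ℤ, ∃ (X : ModuleCat.{u} R) (p : X →ₗ[R] Z k),
        (k ≤ 0 → Module.Projective R X) ∧ (0 < k → InAdd R C X) ∧
        ∀ i : ℤ, k = i + 1 → ∃ j : Z i →ₗ[R] X, IsHomSES R C j p := by
      intro k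
      obtain ⟨i, rfl⟩ : ∃ i, k = i + 1 := ⟨k - 1, by omega⟩
      obtain ⟨X, j, p, h1, h2, h3⟩ := key i _ rfl
      refine ⟨X, p, fun h => h1 (by omega), fun h => h2 (by omega), ?_⟩
      intro i' hi'
      obtain rfl : i = i' := by omega
      exact ⟨j, h3⟩
    choose X p h1 h2 h3 using key'
    choose j hj using fun i => h3 (i + 1) i rfl
    exact isGCProjective_of_splice Z X p j h1 h2 hj

end CompleteSequences

/-! ### Ext vanishing and w-tilting modules -/

section ExtVanishing

open CategoryTheory Abelian

variable {R : Type u} [Ring R]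

/-- The short complex given by a short exact sequence. -/
theorem shortComplex_shortExact {M X N : ModuleCat.{u} R} {j : M →ₗ[R] X} {p : X →ₗ[R] N}
    (hj : Function.Injective j) (hp : Function.Surjective p) (hjp : Function.Exact j p) :
    (ShortComplex.mk (ModuleCat.ofHom j) (ModuleCat.ofHom p)
      (by ext x; exact hjp.apply_apply_eq_zero x)).ShortExact := by
  have := (ModuleCat.mono_iff_injective (ModuleCat.ofHom j)).2 hj
  have := (ModuleCat.epi_iff_surjective (ModuleCat.ofHom p)).2 hp
  refine ShortComplex.ShortExact.mk' ?_ ‹_› ‹_›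
  rw [ShortComplex.ShortExact.moduleCat_exact_iff_function_exact]
  exact hjp

/-- If every map `M → F` extends to `X` and `Ext^(n+1)(X, F)` and (for `n > 0`) `Ext^n(M, F)`
vanish, then so does `Ext^(n+1)(N, F)`. -/
theorem ext_subsingleton_of_shortExact {M X N F : ModuleCat.{u} R} {j : M →ₗ[R] X}
    {p : X →ₗ[R] N} (hj : Function.Injective j) (hp : Function.Surjective p)
    (hjp : Function.Exact j p) (n : ℕ) (hX : Subsingleton (Ext.{u} X F (n + 1)))
    (h0 : ∀ f : M →ₗ[R] F, ∃ g : X →ₗ[R] F, g ∘ₗ j = f)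
    (hM : n ≠ 0 → Subsingleton (Ext.{u} M F n)) : Subsingleton (Ext.{u} N F (n + 1)) := by
  have hS := shortComplex_shortExact hj hp hjp
  refine subsingleton_of_forall_eq 0 fun x => ?_
  obtain ⟨y, rfl⟩ := Ext.contravariant_sequence_exact₃ hS F x (Subsingleton.elim _ _)
    (add_comm 1 n)
  -- In degree `0`, the class `y` is a map that factors through `j`, and the extension class
  -- composed with `j` is zero.
  by_cases hn : n = 0
  · subst hn
    obtain ⟨f, rfl⟩ := Ext.addEquiv₀.symm.surjective y
    obtain ⟨g, hg⟩ := h0 f.hom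
    have : f = ModuleCat.ofHom j ≫ ModuleCat.ofHom g := by
      ext m; exact (LinearMap.congr_fun hg m).symm
    have h2 := hS.extClass_comp_assoc (Ext.mk₀ (ModuleCat.ofHom g)) (h := add_zero 1)
    rw [Ext.mk₀_comp_mk₀] at h2
    subst this
    exact h2
  · have := hM hn
    rw [Subsingleton.elim y 0, Ext.comp_zero]

/-- Dimension shift: $\mathrm{Ext}^n(X,F)\to\mathrm{Ext}^n(M,F)\to\mathrm{Ext}^{n+1}(N,F)$ is exact.
-/
theorem ext_subsingleton_of_kernel {M X N F : ModuleCat.{u} R} {j : M →ₗ[R] X}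
    {p : X →ₗ[R] N} (hj : Function.Injective j) (hp : Function.Surjective p)
    (hjp : Function.Exact j p) (n : ℕ) (hX : Subsingleton (Ext.{u} X F n))
    (hN : Subsingleton (Ext.{u} N F (n + 1))) : Subsingleton (Ext.{u} M F n) := by
  have hS := shortComplex_shortExact hj hp hjp
  refine subsingleton_of_forall_eq 0 fun x => ?_
  obtain ⟨y, rfl⟩ := Ext.contravariant_sequence_exact₁ hS F x (add_comm 1 n)
    (hN.elim _ _)
  rw [hX.elim y 0, Ext.comp_zero]

theorem exists_extension_of_ext_subsingleton {M X N F : ModuleCat.{u} R} {j : M →ₗ[R] X}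
    {p : X →ₗ[R] N} (hj : Function.Injective j) (hp : Function.Surjective p)
    (hjp : Function.Exact j p) (hN : Subsingleton (Ext.{u} N F 1)) (f : M →ₗ[R] F) :
    ∃ g : X →ₗ[R] F, g ∘ₗ j = f := by
  have hS := shortComplex_shortExact hj hp hjp
  obtain ⟨y, hy⟩ := Ext.contravariant_sequence_exact₁ hS F (Ext.mk₀ (ModuleCat.ofHom f))
    (add_comm 1 0) (hN.elim _ _)
  obtain ⟨g, rfl⟩ := Ext.addEquiv₀.symm.surjective y
  refine ⟨g.hom, ?_⟩
  have : Ext.mk₀ (ModuleCat.ofHom j ≫ g) = Ext.mk₀ (ModuleCat.ofHom f) := by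
    rw [← Ext.mk₀_comp_mk₀]; exact hy
  have h2 := (Ext.mk₀_bijective _ _).1 this
  exact congrArg ModuleCat.Hom.hom h2

theorem ext_subsingleton_of_module_projective {P F : ModuleCat.{u} R} (hP : Module.Projective R P)
    (n : ℕ) : Subsingleton (Ext.{u} P F (n + 1)) :=
  have : Projective P := (IsProjective.iff_projective P).1 hP
  subsingleton_of_forall_eq 0 fun x => Ext.eq_zero_of_projective x

variable {C : Type u} [AddCommGroup C] [Module R C]

/-- Relative projective resolutions exist if and only if the relevant `Ext` groups vanish. -/
theorem hasProjResolution_iff (M : ModuleCat.{u} R) : HasProjResolution R C M ↔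
    ∀ (I : Type u) (n : ℕ), Subsingleton (Ext.{u} M (ModuleCat.of R (I →₀ C)) (n + 1)) := by
  constructor
  · rintro hM I n
    induction n generalizing M with
    | zero =>
      obtain ⟨K, Q, j, p, hQ, hK, h⟩ := hM.step
      exact ext_subsingleton_of_shortExact h.inj h.surj h.exact 0
        (ext_subsingleton_of_module_projective hQ 0) (h.ext _ (InAdd.finsupp_self C I))
        (fun h => absurd rfl h)
    | succ n ih =>
      obtain ⟨K, Q, j, p, hQ, hK, h⟩ := hM.step
      exact ext_subsingleton_of_shortExact h.inj h.surj h.exact (n + 1)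
        (ext_subsingleton_of_module_projective hQ _) (h.ext _ (InAdd.finsupp_self C I))
        (fun _ => ih K hK)
  · intro hM
    -- The Ext-vanishing modules form an invariant class: the kernel of the free cover inherits the
    -- vanishing, and degree `1` gives relative exactness.
    refine ⟨fun M => ∀ (I : Type u) (n : ℕ),
      Subsingleton (Ext.{u} M (ModuleCat.of R (I →₀ C)) (n + 1)), hM, fun N hN => ?_⟩
    let p : (N →₀ R) →ₗ[R] N := Finsupp.linearCombination R id
    have hp : Function.Surjective p := fun x => ⟨Finsupp.single x 1, by simp [p]⟩
    have hj : Function.Injective (LinearMap.ker p).subtype := Subtype.val_injective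
    have hjp : Function.Exact (LinearMap.ker p).subtype p := LinearMap.exact_subtype_ker_map p
    refine ⟨ModuleCat.of R (LinearMap.ker p), ModuleCat.of R (N →₀ R), (LinearMap.ker p).subtype, p,
      inferInstanceAs (Module.Projective R (N →₀ R)), fun I n => ?_, ?_⟩
    · exact ext_subsingleton_of_kernel (X := ModuleCat.of R (N →₀ R))
        (M := ModuleCat.of R (LinearMap.ker p)) hj hp hjp _
        (ext_subsingleton_of_module_projective (inferInstanceAs (Module.Projective R (N →₀ R))) n)
        (hN I (n + 1))
    · exact IsHomSES.of_finsupp hj hp hjp fun I =>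
        exists_extension_of_ext_subsingleton (X := ModuleCat.of R (N →₀ R))
          (M := ModuleCat.of R (LinearMap.ker p)) (F := ModuleCat.of R (I →₀ C)) hj hp hjp
          (hN I 0)

/-- By the Ext criterion this is the long exact sequence. Relative exactness of `hs` is what kills
$\mathrm{Ext}^1(N,-)$, since $\mathrm{Hom}(M,-)$ itself does not vanish. -/
theorem HasProjResolution.of_cokernel {M X N : ModuleCat.{u} R} {i : M →ₗ[R] X}
    {q : X →ₗ[R] N} (hs : IsHomSES R C i q) (hM : HasProjResolution R C M)
    (hX : HasProjResolution R C X) : HasProjResolution R C N := by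
  rw [hasProjResolution_iff] at *
  intro I n
  refine ext_subsingleton_of_shortExact hs.inj hs.surj hs.exact n (hX I n)
    (hs.ext _ (InAdd.finsupp_self C I)) fun hn => ?_
  obtain ⟨m, rfl⟩ := Nat.exists_eq_succ_of_ne_zero hn
  exact hM I m

theorem HasProjResolution.of_retract {X Y : ModuleCat.{u} R} (hX : HasProjResolution R C X)
    (s : Y →ₗ[R] X) (r : X →ₗ[R] Y) (hrs : r ∘ₗ s = LinearMap.id) : HasProjResolution R C Y := by
  rw [hasProjResolution_iff] at *
  intro I n
  refine subsingleton_of_forall_eq 0 fun x => ?_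
  have h1 : ModuleCat.ofHom s ≫ ModuleCat.ofHom r = 𝟙 Y := by
    rw [← ModuleCat.ofHom_comp, hrs]; rfl
  rw [← Ext.mk₀_id_comp x, ← h1, ← Ext.mk₀_comp_mk₀_assoc,
    (hX I n).elim ((Ext.mk₀ (ModuleCat.ofHom r)).comp x (zero_add _)) 0, Ext.comp_zero]

/-- This is the use of the Ext condition in the definition of w-tilting; the coresolution of `R`
there serves the next lemma. -/
theorem IsWTilting.hasProjResolution_of_inAdd (hC : IsWTilting R C) {X : ModuleCat.{u} R}
    (hX : InAdd R C X) : HasProjResolution R C X := by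
  have h1 : HasProjResolution R C (ModuleCat.of R C) :=
    (hasProjResolution_iff _).2 fun I n => hC.1 I (n + 1) (by omega)
  obtain ⟨I, s, r, hrs⟩ := hX
  exact (h1.finsupp I).of_retract s r hrs

theorem IsWTilting.hasAddCoresolution_of_projective (hC : IsWTilting R C) {X : ModuleCat.{u} R}
    (hX : Module.Projective R X) : HasAddCoresolution R C X := by
  obtain ⟨-, S, h0, ⟨e⟩, hA, hS, hSC⟩ := hC
  -- The terms of negative index vanish, so exactness at index `0` identifies `R` with the image of
  -- `S.d 0`.
  have hinj : ∀ k : ℤ, k < 0 → Function.Injective (S.d (k + 1)) := by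
    intro k hk
    rw [injective_iff_map_eq_zero]
    intro x hx
    obtain ⟨y, rfl⟩ := (hS k x).1 hx
    have := h0 k hk
    rw [Subsingleton.elim y 0, map_zero]
  replace hinj : Function.Injective (S.d 0) :=
    (by norm_num : (-1 : ℤ) + 1 = 0) ▸ hinj (-1) (by simp)
  have h1 : HasAddCoresolution R C (ModuleCat.of R R) :=
    ModSeq.hasAddCoresolution hA hS hSC le_rfl
      (e.symm.trans (LinearEquiv.ofInjective (S.d 0) hinj))
  obtain ⟨s, hs⟩ := hX
  exact (h1.finsupp X).of_retract s (Finsupp.linearCombination R id) (LinearMap.ext hs)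

/-- If projective modules have relative coresolutions and modules in `Add_R(C)` have relative
projective resolutions, all images of the maps in a complete sequence are `G_C`-projective. -/
theorem ModSeq.isGCProjective_range {S : ModSeq R}
    (h₁ : ∀ X : ModuleCat.{u} R, Module.Projective R X → HasAddCoresolution R C X)
    (h₂ : ∀ X : ModuleCat.{u} R, InAdd R C X → HasProjResolution R C X)
    (hP : S.IsProjAdd C) (hS : S.IsExact) (hSC : S.HomAddExact C) (i : ℤ) :
    IsGCProjective R C (LinearMap.range (S.d i)) := by
  suffices h : ∀ i : ℤ, IsGCProjective R C (ModuleCat.of R (LinearMap.range (S.d i))) from h i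
  -- Only one half is missing on each side of index `0`. To the left, coresolutions pass to kernels,
  -- starting from those of the projective terms.
  have hR : ∀ n : ℕ, HasAddCoresolution R C
      (ModuleCat.of R (LinearMap.range (S.d (-(n : ℤ))))) := by
    intro n
    induction n with
    | zero => exact ModSeq.hasAddCoresolution hP.2 hS hSC le_rfl (LinearEquiv.refl R _)
    | succ n ih =>
      have h : (-(n : ℤ)) = -((n + 1 : ℕ) : ℤ) + 1 := by push_cast; ring
      rw [h] at ih
      exact HasAddCoresolution.of_kernel (X := S.X (-((n + 1 : ℕ) : ℤ) + 1))
        (M := ModuleCat.of R (LinearMap.range (S.d _))) (ModSeq.isHomSES hS hSC _)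
        (h₁ _ (hP.1 _ (by omega))) ih
  -- To the right, projective resolutions pass to cokernels, starting from those of the terms in
  -- `Add_R(C)`.
  have hL : ∀ n : ℕ, HasProjResolution R C (ModuleCat.of R (LinearMap.range (S.d (n : ℤ)))) := by
    intro n
    induction n with
    | zero => exact ModSeq.hasProjResolution hP hS hSC le_rfl (LinearEquiv.refl R _)
    | succ n ih =>
      exact HasProjResolution.of_cokernel (X := S.X ((n : ℤ) + 1))
        (N := ModuleCat.of R (LinearMap.range (S.d ((n : ℤ) + 1)))) (ModSeq.isHomSES hS hSC _) ih
        (h₂ _ (hP.2 _ (by omega)))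
  intro i
  rw [isGCProjective_iff]
  constructor
  · obtain h | h := le_total i 0
    · exact ModSeq.hasProjResolution hP hS hSC h (LinearEquiv.refl R _)
    · lift i to ℕ using h
      exact hL i
  · obtain h | h := le_total 0 i
    · exact ModSeq.hasAddCoresolution hP.2 hS hSC h (LinearEquiv.refl R _)
    · obtain ⟨n, rfl⟩ : ∃ n : ℕ, i = -(n : ℤ) := ⟨i.natAbs, by omega⟩
      exact hR n

theorem IsWTilting.isGCProjective_range (hC : IsWTilting R C) (S : ModSeq R)
    (hP : S.IsProjAdd C) (hS : S.IsExact) (hSC : S.HomAddExact C) (i : ℤ) :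
    IsGCProjective R C (LinearMap.range (S.d i)) :=
  ModSeq.isGCProjective_range (fun _ => hC.hasAddCoresolution_of_projective)
    (fun _ => hC.hasProjResolution_of_inAdd) hP hS hSC i

end ExtVanishing

/-! ### Gorenstein projective modules as the case `C = R` -/

section Gorenstein

variable {R : Type u} [Ring R]

/-- For `C = R` the projectives coincide with `Add_R(C)`, so the required resolutions and
coresolutions are identity maps continued by zero. -/
theorem isGCProjective_range_of_self (S : ModSeq R)
    (hP : S.IsProjAdd R) (hS : S.IsExact) (hSC : S.HomAddExact R) (i : ℤ) :
    IsGCProjective R R (LinearMap.range (S.d i)) := by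
  refine ModSeq.isGCProjective_range (fun X hX => ?_) (fun X hX => ?_) hP hS hSC i
  · refine ⟨fun N => Module.Projective R N, hX, fun N hN => ?_⟩
    refine ⟨N, ModuleCat.of R PUnit, LinearMap.id, 0, (inAdd_self_iff N).2 hN,
      inferInstanceAs (Module.Projective R PUnit.{u + 1}), IsHomSES.of_split LinearMap.id rfl
      (fun x => ⟨0, Subsingleton.elim _ _⟩)
      fun x => ⟨fun _ => ⟨x, rfl⟩, fun _ => rfl⟩⟩
  · refine ⟨fun N => Module.Projective R N, (inAdd_self_iff X).1 hX, fun N hN => ?_⟩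
    refine ⟨ModuleCat.of R PUnit, N, 0, LinearMap.id, hN,
      inferInstanceAs (Module.Projective R PUnit.{u + 1}),
      IsHomSES.of_split 0 (LinearMap.ext fun x => Subsingleton.elim _ _)
      Function.surjective_id fun x => ⟨fun h => ⟨0, h.symm⟩, ?_⟩⟩
    rintro ⟨_, rfl⟩
    rfl

/-- Gorenstein projective means `G_C`-projective if `Add_R(C)` is the class of all projective
modules. -/
theorem isGorensteinProjective_iff {C : Type u} [AddCommGroup C] [Module R C]
    (hC : ∀ X : ModuleCat.{u} R, InAdd R C X ↔ Module.Projective R X) (M : Type u)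
    [AddCommGroup M] [Module R M] : IsGorensteinProjective R M ↔ IsGCProjective R C M := by
  constructor
  · rintro ⟨S, h1, h2, h3, h4⟩
    exact ⟨S, ⟨fun i _ => h1 i, fun i _ => (hC _).2 (h1 i)⟩, h2, fun F hF => h3 F ((hC F).1 hF), h4⟩
  · rintro ⟨S, h1, h2, h3, h4⟩
    exact ⟨S, fun i => (le_or_gt i 0).elim (h1.1 i) fun hi => (hC _).1 (h1.2 i hi), h2,
      fun F hF => h3 F ((hC F).2 hF), h4⟩

theorem ModSeq.HomExact.of_retract {S : ModSeq R} {F G : Type u} [AddCommGroup F] [Module R F]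
    [AddCommGroup G] [Module R G] (h : S.HomExact F) (s : G →ₗ[R] F) (r : F →ₗ[R] G)
    (hrs : r ∘ₗ s = LinearMap.id) : S.HomExact G := by
  intro i f
  constructor
  · intro hf
    obtain ⟨g, hg⟩ := (h i (s ∘ₗ f)).1 (by
      change (s ∘ₗ f) ∘ₗ S.d i = 0
      rw [LinearMap.comp_assoc, show f ∘ₗ S.d i = 0 from hf, LinearMap.comp_zero])
    refine ⟨r ∘ₗ g, ?_⟩
    change (r ∘ₗ g) ∘ₗ S.d (i + 1) = f
    rw [LinearMap.comp_assoc, show g ∘ₗ S.d (i + 1) = s ∘ₗ f from hg, ← LinearMap.comp_assoc,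
      hrs, LinearMap.id_comp]
  · rintro ⟨g, rfl⟩
    -- The sequence is not assumed to be a complex, so this vanishing has to be inherited from `F`
    -- through the split monomorphism `s`.
    have h1 := (h i (s ∘ₗ g ∘ₗ S.d (i + 1))).2 ⟨s ∘ₗ g, rfl⟩
    change (g ∘ₗ S.d (i + 1)) ∘ₗ S.d i = 0
    rw [← LinearMap.id_comp g, ← hrs]
    simp only [LinearMap.comp_assoc] at h1 ⊢
    rw [h1, LinearMap.comp_zero]

/-- Allows $\mathbf p(Z,0)$ and $\mathbf p(0,Z)$ as test modules in the converse direction. -/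
theorem isGCProjective_of_subsingleton (C M : Type u) [AddCommGroup C] [Module R C]
    [AddCommGroup M] [Module R M] [Subsingleton M] : IsGCProjective R C M := by
  refine ⟨⟨fun _ => ModuleCat.of R PUnit, fun _ => 0⟩,
    ⟨fun i _ => inferInstanceAs (Module.Projective R PUnit.{u + 1}),
      fun i _ => InAdd.of_subsingleton C PUnit⟩, fun i x => ?_, fun F hF i f => ?_, ⟨?_⟩⟩
  · exact ⟨fun _ => ⟨0, rfl⟩, fun _ => rfl⟩
  · have : f = 0 := LinearMap.ext fun (x : PUnit) => map_zero f
    subst this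
    exact ⟨fun _ => ⟨0, rfl⟩, fun _ => LinearMap.zero_comp _⟩
  · have : Subsingleton (LinearMap.range (0 : PUnit.{u + 1} →ₗ[R] PUnit.{u + 1})) := inferInstance
    exact { (0 : M →ₗ[R] LinearMap.range (0 : PUnit.{u + 1} →ₗ[R] PUnit.{u + 1})) with
      invFun := 0
      left_inv := fun _ => Subsingleton.elim _ _
      right_inv := fun _ => this.elim _ _ }

end Gorenstein

/-! ### Right exactness of the tensor product -/

section TensorExactness

variable {A B U : Type u} [Ring A] [Ring B] [AddCommGroup U] [Module B U] [Module Aᵐᵒᵖ U]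
  {M N L : Type u} [AddCommGroup M] [Module A M] [AddCommGroup N] [Module A N]
  [AddCommGroup L] [Module A L]

theorem BTensor.induction {motive : BTensor A B U M → Prop}
    (tmul : ∀ (x : U) (m : M), motive (btmul A B x m))
    (add : ∀ s t, motive s → motive t → motive (s + t)) (t : BTensor A B U M) : motive t := by
  obtain ⟨t, rfl⟩ := (tensorRel A B U M).mkQ_surjective t
  induction t using TensorProduct.induction_on with
  | zero => simpa [btmul] using tmul 0 0
  | tmul x m => exact tmul x m
  | add s t hs ht => rw [map_add]; exact add _ _ hs ht

@[simp]
theorem btensorMap_btmul (f : M →ₗ[A] N) (x : U) (m : M) :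
    btensorMap A B U f (btmul A B x m) = btmul A B x (f m) :=
  rfl

theorem BTensor.hom_ext {V : Type u} [AddCommGroup V] [Module B V]
    {f g : BTensor A B U M →ₗ[B] V} (h : ∀ x m, f (btmul A B x m) = g (btmul A B x m)) : f = g := by
  refine LinearMap.ext fun t => ?_
  induction t using BTensor.induction with
  | tmul x m => exact h x m
  | add s t hs ht => rw [map_add, map_add, hs, ht]

theorem btensorMap_comp (g : N →ₗ[A] L) (f : M →ₗ[A] N) :
    btensorMap A B U (g ∘ₗ f) = btensorMap A B U g ∘ₗ btensorMap A B U f :=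
  BTensor.hom_ext fun _ _ => rfl

theorem btensorMap_comp_apply (g : N →ₗ[A] L) (f : M →ₗ[A] N) (t : BTensor A B U M) :
    btensorMap A B U (g ∘ₗ f) t = btensorMap A B U g (btensorMap A B U f t) := by
  rw [btensorMap_comp, LinearMap.comp_apply]

theorem btensorMap_id : btensorMap A B U (LinearMap.id : M →ₗ[A] M) = LinearMap.id :=
  BTensor.hom_ext fun _ _ => rfl

theorem btensorMap_zero : btensorMap A B U (0 : M →ₗ[A] N) = 0 :=
  BTensor.hom_ext fun x _ => btmul_zero_right A B U x

theorem btensorMap_surjective {f : M →ₗ[A] N} (hf : Function.Surjective f) :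
    Function.Surjective (btensorMap A B U f) := by
  intro t
  induction t using BTensor.induction with
  | tmul x n =>
    obtain ⟨m, rfl⟩ := hf n
    exact ⟨btmul A B x m, rfl⟩
  | add s t hs ht =>
    obtain ⟨a, rfl⟩ := hs
    obtain ⟨b, rfl⟩ := ht
    exact ⟨a + b, map_add _ _ _⟩

/-- The functor `U ⊗_A -` is right exact. -/
theorem btensorMap_exact {f : M →ₗ[A] N} {g : N →ₗ[A] L} (hfg : Function.Exact f g)
    (hg : Function.Surjective g) :
    Function.Exact (btensorMap A B U f) (btensorMap A B U g) := by
  intro t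
  constructor
  · intro ht
    obtain ⟨t, rfl⟩ := (tensorRel A B U N).mkQ_surjective t
    let G := TensorProduct.AlgebraTensorModule.lTensor B U g.toAddMonoidHom.toIntLinearMap
    -- As `g` is surjective, relations over `L` lift to relations over `N`. Subtracting such a lift
    -- reduces the claim to right exactness over ℤ.
    have hrel : tensorRel A B U L ≤ (tensorRel A B U N).map G := by
      refine Submodule.span_le.2 ?_
      rintro _ ⟨x, a, l, rfl⟩
      obtain ⟨n, rfl⟩ := hg l
      refine ⟨_, Submodule.subset_span ⟨x, a, n, rfl⟩, ?_⟩
      simp [G]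
    obtain ⟨r, hr, hr'⟩ := hrel ((Submodule.Quotient.mk_eq_zero _).1 ht)
    have hex : Function.Exact (LinearMap.lTensor U f.toAddMonoidHom.toIntLinearMap)
        (LinearMap.lTensor U g.toAddMonoidHom.toIntLinearMap) :=
      lTensor_exact U hfg hg
    obtain ⟨s, hs⟩ := (hex (t - r)).1 (by
      rw [map_sub, sub_eq_zero]; exact hr'.symm)
    refine ⟨(tensorRel A B U M).mkQ s, ?_⟩
    have h1 : (tensorRel A B U N).mkQ r = 0 := (Submodule.Quotient.mk_eq_zero _).2 hr
    rw [← sub_zero ((tensorRel A B U N).mkQ t), ← h1, ← map_sub, ← hs]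
    rfl
  · rintro ⟨s, rfl⟩
    have : g ∘ₗ f = 0 := LinearMap.ext hfg.apply_apply_eq_zero
    rw [← btensorMap_comp_apply, this, btensorMap_zero, LinearMap.zero_apply]

variable (A B U) in
/-- The canonical map `U ⊗_A A → U`. -/
noncomputable def btensorSelf [SMulCommClass B Aᵐᵒᵖ U] : BTensor A B U A →ₗ[B] U :=
  (tensorRel A B U A).liftQ
    (TensorProduct.AlgebraTensorModule.lift
      (LinearMap.mk₂' B ℤ (fun (x : U) (a : A) => MulOpposite.op a • x)
        (fun x y a => smul_add _ x y) (fun b x a => (smul_comm b (MulOpposite.op a) x).symm)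
        (fun x a b => by rw [MulOpposite.op_add, add_smul])
        (fun n x a => by rw [MulOpposite.op_smul, smul_assoc])))
    (by
      refine Submodule.span_le.2 ?_
      rintro _ ⟨x, a, m, rfl⟩
      simp [mul_smul])

@[simp]
theorem btensorSelf_btmul [SMulCommClass B Aᵐᵒᵖ U] (x : U) (a : A) :
    btensorSelf A B U (btmul A B x a) = MulOpposite.op a • x :=
  rfl

instance [Subsingleton M] : Subsingleton (BTensor A B U M) :=
  ⟨fun s t => by
    have h : ∀ t : BTensor A B U M, t = 0 := fun t => by
      induction t using BTensor.induction with
      | tmul x m => rw [Subsingleton.elim m 0, btmul_zero_right]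
      | add s t hs ht => rw [hs, ht, add_zero]
    rw [h s, h t]⟩

end TensorExactness

/-! ### The functor `p`: morphisms, direct sums, projectives -/

section PMod

variable {A B U : Type u} [Ring A] [Ring B] [AddCommGroup U] [Module B U] [Module Aᵐᵒᵖ U]
  {M₁ M₂ N₁ N₂ L₁ L₂ : Type u} [AddCommGroup M₁] [Module A M₁] [AddCommGroup M₂] [Module B M₂]
  [AddCommGroup N₁] [Module A N₁] [AddCommGroup N₂] [Module B N₂]
  [AddCommGroup L₁] [Module A L₁] [AddCommGroup L₂] [Module B L₂]

namespace PMod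

/-- The element `(x; (t, y))` of `p(M₁, M₂)`. -/
def mk (x : M₁) (w : BTensor A B U M₁ × M₂) : PMod A B U M₁ M₂ := (x, w)

theorem exists_mk (m : PMod A B U M₁ M₂) : ∃ x t y, m = mk x (t, y) :=
  ⟨m.1, m.2.1, m.2.2, rfl⟩

theorem mk_add (x x' : M₁) (w w' : BTensor A B U M₁ × M₂) :
    mk (x + x') (w + w') = mk x w + mk x' w' :=
  rfl

theorem mk_zero : mk (0 : M₁) (0 : BTensor A B U M₁ × M₂) = 0 :=
  rfl

theorem mk_inj {x x' : M₁} {w w' : BTensor A B U M₁ × M₂} :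
    mk x w = mk x' w' ↔ x = x' ∧ w = w' :=
  Prod.mk_inj

theorem smul_mk (r : TriRing A B U) (x : M₁) (w : BTensor A B U M₁ × M₂) :
    r • mk x w = mk (r.a • x) ((btmul A B r.u x, 0) + r.b • w) :=
  rfl

variable [SMulCommClass B Aᵐᵒᵖ U]

/-- The `T`-linear map `p(M₁, M₂) → p(N₁, N₂)` given by a pair of linear maps. -/
noncomputable def lift (f : M₁ →ₗ[A] N₁) (g : M₂ →ₗ[B] BTensor A B U N₁ × N₂) :
    PMod A B U M₁ M₂ →ₗ[TriRing A B U] PMod A B U N₁ N₂ where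
  toFun m := mk (f m.1) ((btensorMap A B U f m.2.1, 0) + g m.2.2)
  map_add' m m' := by
    obtain ⟨x, t, y, rfl⟩ := exists_mk m
    obtain ⟨x', t', y', rfl⟩ := exists_mk m'
    rw [← mk_add, ← mk_add, mk_inj]
    refine ⟨map_add f x x', ?_⟩
    change (btensorMap A B U f (t + t'), (0 : N₂)) + g (y + y') =
      (btensorMap A B U f t, 0) + g y + ((btensorMap A B U f t', 0) + g y')
    rw [map_add, map_add, ← zero_add (0 : N₂), ← Prod.mk_add_mk, zero_add]
    abel
  map_smul' r m := by
    obtain ⟨x, t, y, rfl⟩ := exists_mk m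
    rw [RingHom.id_apply, smul_mk, smul_mk, mk_inj]
    refine ⟨map_smul f r.a x, ?_⟩
    change (btensorMap A B U f (btmul A B r.u x + r.b • t), (0 : N₂)) + g (0 + r.b • y) =
      (btmul A B r.u (f x), 0) + r.b • ((btensorMap A B U f t, 0) + g y)
    rw [zero_add, map_add, map_smul, map_smul, btensorMap_btmul]
    exact Prod.ext (by simp [add_assoc]) (by simp)

theorem lift_mk (f : M₁ →ₗ[A] N₁) (g : M₂ →ₗ[B] BTensor A B U N₁ × N₂) (x : M₁)
    (t : BTensor A B U M₁) (y : M₂) :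
    lift f g (mk x (t, y)) = mk (f x) ((btensorMap A B U f t, 0) + g y) :=
  rfl

/-- Every `T`-linear map `p(M₁, M₂) → p(N₁, N₂)` is given by a pair of linear maps. -/
theorem exists_eq_lift (h : PMod A B U M₁ M₂ →ₗ[TriRing A B U] PMod A B U N₁ N₂) :
    ∃ f g, h = lift f g := by
  have hsmul : ∀ r m, h (r • m) = r • h m := fun r m => map_smul h r m
  have hadd : ∀ m m', h (m + m') = h m + h m' := map_add h
  let f : M₁ →ₗ[A] N₁ :=
    { toFun := fun x => (h (mk x 0)).1
      map_add' := fun x x' => by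
        have : mk (x + x') (0 : BTensor A B U M₁ × M₂) = mk x 0 + mk x' 0 := by
          rw [← mk_add, add_zero]
        rw [this, hadd]; rfl
      map_smul' := fun a x => by
        have : mk (a • x) (0 : BTensor A B U M₁ × M₂) =
            (⟨a, 0, 0⟩ : TriRing A B U) • mk x 0 := by
          rw [smul_mk, mk_inj]
          refine ⟨rfl, ?_⟩
          rw [btmul_zero_left, zero_smul, add_zero]; rfl
        rw [this, hsmul]; rfl }
  let g : M₂ →ₗ[B] BTensor A B U N₁ × N₂ :=
    { toFun := fun y => (h (mk 0 (0, y))).2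
      map_add' := fun y y' => by
        have : mk (0 : M₁) ((0, y + y') : BTensor A B U M₁ × M₂) =
            mk 0 (0, y) + mk 0 (0, y') := by
          rw [← mk_add, add_zero, Prod.mk_add_mk, add_zero]
        rw [this, hadd]; rfl
      map_smul' := fun b y => by
        have : mk (0 : M₁) ((0, b • y) : BTensor A B U M₁ × M₂) =
            (⟨0, 0, b⟩ : TriRing A B U) • mk 0 (0, y) := by
          rw [smul_mk, mk_inj]
          refine ⟨(smul_zero _).symm, ?_⟩
          rw [btmul_zero_left]; simp
        rw [this, hsmul]
        obtain ⟨x, t, z, hm⟩ := exists_mk (h (mk 0 (0, y)))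
        rw [hm, smul_mk]
        change (btmul A B (0 : U) x, (0 : N₂)) + b • (t, z) = b • (t, z)
        rw [btmul_zero_left]; simp }
  -- The two diagonal idempotents of `T` force `h` to respect the columns `(x; 0)` and `(0; (0,
  -- y))`; the part `U ⊗ M₁` is generated from `(m; 0)` by the lower left entries.
  have h1 : ∀ x, h (mk x 0) = mk (f x) 0 := fun x => by
    have : mk x (0 : BTensor A B U M₁ × M₂) = (⟨1, 0, 0⟩ : TriRing A B U) • mk x 0 := by
      rw [smul_mk, mk_inj]
      refine ⟨(one_smul A x).symm, ?_⟩
      rw [btmul_zero_left, zero_smul, add_zero]; rfl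
    rw [this, hsmul]
    obtain ⟨x', t, z, hm⟩ := exists_mk (h (mk x 0))
    have hf : f x = x' := congrArg Prod.fst hm
    rw [hm, hf, smul_mk, mk_inj]
    refine ⟨one_smul A x', ?_⟩
    change (btmul A B (0 : U) x', (0 : N₂)) + (0 : B) • (t, z) = 0
    rw [btmul_zero_left]; simp
  have h2 : ∀ t, h (mk 0 (t, 0)) = mk 0 (btensorMap A B U f t, 0) := fun t => by
    induction t using BTensor.induction with
    | tmul x m =>
      have : mk (0 : M₁) ((btmul A B x m, 0) : BTensor A B U M₁ × M₂) =
          (⟨0, x, 0⟩ : TriRing A B U) • mk m 0 := by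
        rw [smul_mk, mk_inj]
        exact ⟨(zero_smul A m).symm, by simp⟩
      rw [this, hsmul, h1, smul_mk, mk_inj]
      exact ⟨zero_smul A _, by simp⟩
    | add s t hs ht =>
      have h3 : ∀ (s t : BTensor A B U M₁), mk (0 : M₁) ((s + t, 0) : BTensor A B U M₁ × M₂) =
          mk 0 (s, 0) + mk 0 (t, 0) := fun s t => by
        rw [← mk_add, add_zero, Prod.mk_add_mk, add_zero]
      rw [h3, hadd, hs, ht, ← mk_add, map_add, add_zero, Prod.mk_add_mk, add_zero]
  have h3 : ∀ y, h (mk 0 (0, y)) = mk 0 (g y) := fun y => by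
    have : mk (0 : M₁) ((0, y) : BTensor A B U M₁ × M₂) =
        (⟨0, 0, 1⟩ : TriRing A B U) • mk 0 (0, y) := by
      rw [smul_mk, mk_inj]
      refine ⟨(zero_smul A _).symm, ?_⟩
      rw [btmul_zero_left]; simp
    obtain ⟨x', t, z, hm⟩ := exists_mk (h (mk 0 (0, y)))
    have hx : x' = 0 := by
      rw [this, hsmul] at hm
      exact (congrArg Prod.fst hm).symm.trans (zero_smul A _)
    have hg : g y = (t, z) := congrArg Prod.snd hm
    rw [hm, hg, hx]
  refine ⟨f, g, LinearMap.ext fun m => ?_⟩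
  obtain ⟨x, t, y, rfl⟩ := exists_mk m
  have : mk x (t, y) = mk x 0 + mk 0 (t, 0) + mk 0 (0, y) := by
    rw [← mk_add, ← mk_add, mk_inj]
    simp
  rw [this, hadd, hadd, h1, h2, h3, ← this, lift_mk, ← mk_add, ← mk_add, mk_inj]
  simp

/-- The functor `p` on morphisms. -/
noncomputable def map (f : M₁ →ₗ[A] N₁) (g : M₂ →ₗ[B] N₂) :
    PMod A B U M₁ M₂ →ₗ[TriRing A B U] PMod A B U N₁ N₂ :=
  lift f (LinearMap.inr B _ _ ∘ₗ g)

theorem map_mk (f : M₁ →ₗ[A] N₁) (g : M₂ →ₗ[B] N₂) (x : M₁)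
    (t : BTensor A B U M₁) (y : M₂) :
    map f g (mk x (t, y)) = mk (f x) (btensorMap A B U f t, g y) := by
  rw [map, lift_mk, mk_inj]
  simp

theorem lift_comp_map (f : N₁ →ₗ[A] L₁) (g : N₂ →ₗ[B] BTensor A B U L₁ × L₂) (f' : M₁ →ₗ[A] N₁)
    (g' : M₂ →ₗ[B] N₂) : lift f g ∘ₗ map f' g' = lift (f ∘ₗ f') (g ∘ₗ g') := by
  refine LinearMap.ext fun m => ?_
  obtain ⟨x, t, y, rfl⟩ := exists_mk m
  rw [LinearMap.comp_apply, map_mk, lift_mk, lift_mk, btensorMap_comp_apply]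
  rfl

theorem map_comp (f : N₁ →ₗ[A] L₁) (g : N₂ →ₗ[B] L₂) (f' : M₁ →ₗ[A] N₁) (g' : M₂ →ₗ[B] N₂) :
    (map f g ∘ₗ map f' g' : PMod A B U M₁ M₂ →ₗ[TriRing A B U] _) = map (f ∘ₗ f') (g ∘ₗ g') :=
  lift_comp_map _ _ _ _

theorem map_id : (map LinearMap.id LinearMap.id : PMod A B U M₁ M₂ →ₗ[TriRing A B U] _) =
    LinearMap.id := by
  refine LinearMap.ext fun m => ?_
  obtain ⟨x, t, y, rfl⟩ := exists_mk m
  rw [map_mk, btensorMap_id]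
  rfl

theorem lift_eq_iff {f f' : M₁ →ₗ[A] N₁} {g g' : M₂ →ₗ[B] BTensor A B U N₁ × N₂} :
    lift f g = lift f' g' ↔ f = f' ∧ g = g' := by
  constructor
  · intro h
    constructor
    · ext x
      have := LinearMap.congr_fun h (mk x (0, 0))
      rw [lift_mk, lift_mk, mk_inj] at this
      exact this.1
    · refine LinearMap.ext fun y => ?_
      have := LinearMap.congr_fun h (mk 0 (0, y))
      rw [lift_mk, lift_mk, mk_inj] at this
      simpa using this.2
  · rintro ⟨rfl, rfl⟩
    rfl

theorem lift_zero : lift (0 : M₁ →ₗ[A] N₁) (0 : M₂ →ₗ[B] BTensor A B U N₁ × N₂) = 0 := by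
  refine LinearMap.ext fun m => ?_
  obtain ⟨x, t, y, rfl⟩ := exists_mk m
  rw [lift_mk, btensorMap_zero]
  exact mk_inj.2 ⟨rfl, by simp⟩

theorem map_surjective {f : M₁ →ₗ[A] N₁} {g : M₂ →ₗ[B] N₂} (hf : Function.Surjective f)
    (hg : Function.Surjective g) :
    Function.Surjective (map f g : PMod A B U M₁ M₂ →ₗ[TriRing A B U] _) := by
  intro n
  obtain ⟨x, t, y, rfl⟩ := exists_mk n
  obtain ⟨x, rfl⟩ := hf x
  obtain ⟨t, rfl⟩ := btensorMap_surjective hf t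
  obtain ⟨y, rfl⟩ := hg y
  exact ⟨mk x (t, y), map_mk f g x t y⟩

theorem map_injective {f : M₁ →ₗ[A] N₁} {g : M₂ →ₗ[B] N₂} (hf : Function.Injective f)
    (hf' : Function.Injective (btensorMap A B U f)) (hg : Function.Injective g) :
    Function.Injective (map f g : PMod A B U M₁ M₂ →ₗ[TriRing A B U] _) := by
  intro m m' h
  obtain ⟨x, t, y, rfl⟩ := exists_mk m
  obtain ⟨x', t', y', rfl⟩ := exists_mk m'
  rw [map_mk, map_mk, mk_inj, Prod.mk_inj] at h
  rw [hf h.1, hf' h.2.1, hg h.2.2]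

theorem map_exact {f : M₁ →ₗ[A] N₁} {g : M₂ →ₗ[B] N₂} {f' : N₁ →ₗ[A] L₁} {g' : N₂ →ₗ[B] L₂}
    (hf : Function.Exact f f') (hf' : Function.Exact (btensorMap A B U f) (btensorMap A B U f'))
    (hg : Function.Exact g g') :
    Function.Exact (map f g : PMod A B U M₁ M₂ →ₗ[TriRing A B U] _)
      (map f' g' : PMod A B U N₁ N₂ →ₗ[TriRing A B U] _) := by
  intro n
  obtain ⟨x, t, y, rfl⟩ := exists_mk n
  rw [map_mk, ← mk_zero, mk_inj, Prod.mk_eq_zero, hf x, hf' t, hg y]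
  constructor
  · rintro ⟨⟨x, rfl⟩, ⟨t, rfl⟩, ⟨y, rfl⟩⟩
    exact ⟨mk x (t, y), map_mk _ _ _ _ _⟩
  · rintro ⟨m, hm⟩
    obtain ⟨x', t', y', rfl⟩ := exists_mk m
    rw [map_mk, mk_inj, Prod.mk_inj] at hm
    exact ⟨⟨x', hm.1⟩, ⟨t', hm.2.1⟩, ⟨y', hm.2.2⟩⟩

/-- A submodule containing all `(x; 0)` and all `(0; (0, y))` is everything. -/
theorem submodule_eq_top (W : Submodule (TriRing A B U) (PMod A B U M₁ M₂))
    (h₁ : ∀ x, mk x 0 ∈ W) (h₂ : ∀ y, mk 0 (0, y) ∈ W) : W = ⊤ := by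
  refine eq_top_iff.2 fun m _ => ?_
  obtain ⟨x, t, y, rfl⟩ := exists_mk m
  have ht : ∀ t, mk 0 (t, 0) ∈ W := fun t => by
    induction t using BTensor.induction with
    | tmul x m =>
      have : mk (0 : M₁) ((btmul A B x m, 0) : BTensor A B U M₁ × M₂) =
          (⟨0, x, 0⟩ : TriRing A B U) • mk m 0 := by
        rw [smul_mk, mk_inj]
        exact ⟨(zero_smul A m).symm, by simp⟩
      exact this ▸ W.smul_mem _ (h₁ m)
    | add s t hs ht =>
      have := W.add_mem hs ht
      rwa [← mk_add, add_zero, Prod.mk_add_mk, add_zero] at this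
  have := W.add_mem (W.add_mem (h₁ x) (ht t)) (h₂ y)
  rw [← mk_add, ← mk_add] at this
  simpa using this

variable (A B U) in
/-- `p` commutes with direct sums of copies. -/
theorem nonempty_finsuppEquiv (C₁ C₂ I : Type u) [AddCommGroup C₁] [Module A C₁] [AddCommGroup C₂]
    [Module B C₂] : Nonempty ((I →₀ PMod A B U C₁ C₂) ≃ₗ[TriRing A B U]
      PMod A B U (I →₀ C₁) (I →₀ C₂)) := by
  let Φ : (I →₀ PMod A B U C₁ C₂) →ₗ[TriRing A B U] PMod A B U (I →₀ C₁) (I →₀ C₂) :=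
    Finsupp.lsum ℕ fun i => map (Finsupp.lsingle i) (Finsupp.lsingle i)
  have hΦ : ∀ i m, Φ (Finsupp.single i m) = map (Finsupp.lsingle i) (Finsupp.lsingle i) m :=
    fun i m => Finsupp.lsum_single ℕ _ i m
  refine ⟨LinearEquiv.ofBijective Φ ⟨?_, ?_⟩⟩
  · have hproj : ∀ i, map (Finsupp.lapply i) (Finsupp.lapply i) ∘ₗ Φ = Finsupp.lapply i := by
      intro i
      refine Finsupp.lhom_ext fun k m => ?_
      obtain ⟨x, t, y, rfl⟩ := exists_mk m
      rw [LinearMap.comp_apply, hΦ, map_mk, map_mk, ← btensorMap_comp_apply]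
      by_cases hk : k = i
      · subst hk
        have : (Finsupp.lapply k ∘ₗ Finsupp.lsingle k : C₁ →ₗ[A] C₁) = LinearMap.id := by
          ext; simp
        rw [this, btensorMap_id]
        simp
      · have : (Finsupp.lapply i ∘ₗ Finsupp.lsingle k : C₁ →ₗ[A] C₁) = 0 := by
          ext; simp [hk]
        rw [this, btensorMap_zero]
        simp [Finsupp.single_eq_of_ne (Ne.symm hk)]
        rfl
    intro m m' h
    ext i : 1
    rw [← Finsupp.lapply_apply (R := TriRing A B U), ← hproj, LinearMap.comp_apply, h,
      ← LinearMap.comp_apply, hproj, Finsupp.lapply_apply]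
  · rw [← LinearMap.range_eq_top]
    refine submodule_eq_top _ (fun x => ?_) fun y => ?_
    · induction x using Finsupp.induction_linear with
      | zero => exact Submodule.zero_mem _
      | add x x' hx hx' =>
        have := Submodule.add_mem _ hx hx'
        rwa [← mk_add, add_zero] at this
      | single i x =>
        refine ⟨Finsupp.single i (mk x (0, 0)), ?_⟩
        rw [hΦ, map_mk, map_zero, map_zero]
        rfl
    · induction y using Finsupp.induction_linear with
      | zero => exact Submodule.zero_mem _
      | add x x' hx hx' =>
        have := Submodule.add_mem _ hx hx'
        rwa [← mk_add, add_zero, Prod.mk_add_mk, add_zero] at this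
      | single i x =>
        refine ⟨Finsupp.single i (mk 0 (0, x)), ?_⟩
        rw [hΦ, map_mk]; simp

theorem inAdd {C₁ C₂ : Type u} [AddCommGroup C₁] [Module A C₁] [AddCommGroup C₂] [Module B C₂]
    (h₁ : InAdd A C₁ M₁) (h₂ : InAdd B C₂ M₂) :
    InAdd (TriRing A B U) (PMod A B U C₁ C₂) (PMod A B U M₁ M₂) := by
  obtain ⟨I, s, r, h⟩ := h₁
  obtain ⟨J, s', r', h'⟩ := h₂
  -- A direct sum of copies of `p(C₁, C₂)` uses one index set for both components. With `I ⊕ J`,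
  -- `M₁` sits in the `I`-half and `M₂` in the `J`-half.
  obtain ⟨e⟩ := nonempty_finsuppEquiv A B U C₁ C₂ (I ⊕ J)
  let E := Finsupp.sumFinsuppLEquivProdFinsupp (M := C₁) (α := I) (β := J) A
  let E' := Finsupp.sumFinsuppLEquivProdFinsupp (M := C₂) (α := I) (β := J) B
  refine ((InAdd.finsupp_self _ (I ⊕ J)).congr e).of_retract
    (map (E.symm.toLinearMap ∘ₗ LinearMap.inl A _ _ ∘ₗ s)
      (E'.symm.toLinearMap ∘ₗ LinearMap.inr B _ _ ∘ₗ s'))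
    (map (r ∘ₗ LinearMap.fst A _ _ ∘ₗ E.toLinearMap)
      (r' ∘ₗ LinearMap.snd B _ _ ∘ₗ E'.toLinearMap)) ?_
  rw [map_comp, ← map_id]
  congr 1
  · rw [← h]; ext; simp
  · rw [← h']; ext; simp

variable (A B U) in
/-- `p(A, B)` is the regular module. -/
theorem nonempty_equiv_self : Nonempty (TriRing A B U ≃ₗ[TriRing A B U] PMod A B U A B) := by
  refine ⟨LinearEquiv.ofBijective (LinearMap.toSpanSingleton _ _ (mk 1 (0, 1))) ⟨?_, ?_⟩⟩
  · intro r r' h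
    simp only [LinearMap.toSpanSingleton_apply, smul_mk, mk_inj, Prod.mk_inj, Prod.smul_mk,
      Prod.mk_add_mk, smul_zero, add_zero, zero_add, smul_eq_mul, mul_one] at h
    refine TriRing.ext h.1 ?_ h.2.2
    -- The lower left entry `u` appears as `u ⊗ 1`, and the canonical map to `U` recovers it.
    simpa using congrArg (btensorSelf A B U) h.2.1
  · rw [← LinearMap.range_eq_top]
    refine submodule_eq_top _ (fun x => ⟨⟨x, 0, 0⟩, ?_⟩) fun y => ⟨⟨0, 0, y⟩, ?_⟩
    · rw [LinearMap.toSpanSingleton_apply, smul_mk, mk_inj]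
      simp [btmul_zero_left]
    · rw [LinearMap.toSpanSingleton_apply, smul_mk, mk_inj]
      simp [btmul_zero_left]

theorem inAdd_iff_projective (X : ModuleCat.{u} (TriRing A B U)) :
    InAdd (TriRing A B U) (PMod A B U A B) X ↔ Module.Projective (TriRing A B U) X := by
  obtain ⟨e⟩ := nonempty_equiv_self A B U
  rw [← inAdd_self_iff]
  exact ⟨fun h => h.congr_left e.symm, fun h => h.congr_left e⟩

theorem projective [Module.Projective A M₁] [Module.Projective B M₂] :
    Module.Projective (TriRing A B U) (PMod A B U M₁ M₂) :=
  (inAdd_iff_projective (ModuleCat.of _ (PMod A B U M₁ M₂))).1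
    (inAdd ((inAdd_self_iff _).2 ‹_›) ((inAdd_self_iff _).2 ‹_›))

end PMod

end PMod

/-! ### Weak compatibility and relative Gorenstein projectivity -/

section Main

variable {A B U : Type u} [Ring A] [Ring B] [AddCommGroup U] [Module B U] [Module Aᵐᵒᵖ U]
  [SMulCommClass B Aᵐᵒᵖ U]

theorem ModSeq.HomAddExact.of_finsupp {R C : Type u} [Ring R] [AddCommGroup C] [Module R C]
    {S : ModSeq R} (h : ∀ I : Type u, S.HomExact (I →₀ C)) : S.HomAddExact C := by
  rintro F ⟨I, s, r, hrs⟩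
  exact (h I).of_retract s r hrs

variable (U) in
/-- The functor `p` applied termwise to a pair of sequences. -/
noncomputable def ModSeq.pSeq (S₁ : ModSeq A) (S₂ : ModSeq B) : ModSeq (TriRing A B U) where
  X i := ModuleCat.of (TriRing A B U) (PMod A B U (S₁.X i) (S₂.X i))
  d i := PMod.map (S₁.d i) (S₂.d i)

/-- $\mathrm{Hom}_T(\mathbf p(X_1,X_2),\mathbf p(Y_1,Y_2))$ is naturally the product of
$\mathrm{Hom}_A(X_1,Y_1)$, $\mathrm{Hom}_B(X_2,U\otimes_A Y_1)$ and $\mathrm{Hom}_B(X_2,Y_2)$, so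
exactness is checked on three factors. -/
theorem ModSeq.pSeq_homExact {S₁ : ModSeq A} {S₂ : ModSeq B} {Y₁ Y₂ : Type u} [AddCommGroup Y₁]
    [Module A Y₁] [AddCommGroup Y₂] [Module B Y₂] (h₁ : S₁.HomExact Y₁)
    (h₁₂ : S₂.HomExact (BTensor A B U Y₁)) (h₂ : S₂.HomExact Y₂) :
    (ModSeq.pSeq U S₁ S₂).HomExact (PMod A B U Y₁ Y₂) := by
  intro i h
  obtain ⟨f, g, rfl⟩ := PMod.exists_eq_lift h
  constructor
  · intro h0
    replace h0 : PMod.lift f g ∘ₗ PMod.map (S₁.d i) (S₂.d i) = 0 := h0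
    rw [PMod.lift_comp_map, ← PMod.lift_zero, PMod.lift_eq_iff] at h0
    obtain ⟨hf, hg⟩ := h0
    obtain ⟨f', hf'⟩ := (h₁ i f).1 hf
    obtain ⟨g₁, hg₁⟩ := (h₁₂ i (LinearMap.fst B _ _ ∘ₗ g)).1 (by
      change (LinearMap.fst B _ _ ∘ₗ g) ∘ₗ S₂.d i = 0
      rw [LinearMap.comp_assoc, hg, LinearMap.comp_zero])
    obtain ⟨g₂, hg₂⟩ := (h₂ i (LinearMap.snd B _ _ ∘ₗ g)).1 (by
      change (LinearMap.snd B _ _ ∘ₗ g) ∘ₗ S₂.d i = 0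
      rw [LinearMap.comp_assoc, hg, LinearMap.comp_zero])
    refine ⟨PMod.lift f' (g₁.prod g₂), ?_⟩
    refine (PMod.lift_comp_map _ _ _ _).trans (PMod.lift_eq_iff.2 ⟨hf', ?_⟩)
    refine LinearMap.ext fun y => Prod.ext ?_ ?_
    · exact LinearMap.congr_fun hg₁ y
    · exact LinearMap.congr_fun hg₂ y
  · rintro ⟨k, hk⟩
    obtain ⟨f', g', rfl⟩ := PMod.exists_eq_lift k
    replace hk : PMod.lift f' g' ∘ₗ PMod.map (S₁.d (i + 1)) (S₂.d (i + 1)) = PMod.lift f g := hk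
    rw [PMod.lift_comp_map, PMod.lift_eq_iff] at hk
    obtain ⟨rfl, rfl⟩ := hk
    refine (PMod.lift_comp_map _ _ _ _).trans
      ((PMod.lift_eq_iff.2 ⟨(h₁ i _).2 ⟨f', rfl⟩, ?_⟩).trans PMod.lift_zero)
    have e1 : (LinearMap.fst B _ _ ∘ₗ g' ∘ₗ S₂.d (i + 1)) ∘ₗ S₂.d i = 0 :=
      (h₁₂ i _).2 ⟨LinearMap.fst B _ _ ∘ₗ g', rfl⟩
    have e2 : (LinearMap.snd B _ _ ∘ₗ g' ∘ₗ S₂.d (i + 1)) ∘ₗ S₂.d i = 0 :=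
      (h₂ i _).2 ⟨LinearMap.snd B _ _ ∘ₗ g', rfl⟩
    refine LinearMap.ext fun y => Prod.ext ?_ ?_
    · exact LinearMap.congr_fun e1 y
    · exact LinearMap.congr_fun e2 y

/-- Tensor exactness makes $U\otimes_A-$ preserve the inclusion of the image into the next term;
hence $\mathbf p$ commutes with taking images here. -/
theorem ModSeq.pSeq_nonempty_range_equiv {S₁ : ModSeq A} {S₂ : ModSeq B} (hS : S₁.IsExact)
    (hU : S₁.TensorExact A B U) (i : ℤ) :
    Nonempty (PMod A B U (LinearMap.range (S₁.d i)) (LinearMap.range (S₂.d i)) ≃ₗ[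
      TriRing A B U] LinearMap.range ((ModSeq.pSeq U S₁ S₂).d i)) := by
  obtain ⟨i, rfl⟩ : ∃ k, i = k + 1 := ⟨i - 1, by omega⟩
  have hinj : Function.Injective
      (btensorMap A B U (LinearMap.range (S₁.d (i + 1))).subtype) := by
    rw [injective_iff_map_eq_zero]
    intro t ht
    obtain ⟨s, rfl⟩ := btensorMap_surjective (LinearMap.surjective_rangeRestrict (S₁.d (i + 1))) t
    rw [← btensorMap_comp_apply] at ht
    obtain ⟨r, rfl⟩ := (hU i s).1 ht
    rw [← btensorMap_comp_apply]
    have : (S₁.d (i + 1)).rangeRestrict ∘ₗ S₁.d i = 0 := by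
      ext x
      exact (hS i).apply_apply_eq_zero x
    rw [this, btensorMap_zero, LinearMap.zero_apply]
  have h2 := PMod.map_injective (Submodule.subtype_injective _) hinj
    (Submodule.subtype_injective (LinearMap.range (S₂.d (i + 1))))
  have h3 : LinearMap.range ((ModSeq.pSeq U S₁ S₂).d (i + 1)) = LinearMap.range
      (PMod.map (U := U) (LinearMap.range (S₁.d (i + 1))).subtype
        (LinearMap.range (S₂.d (i + 1))).subtype) := by
    have : (ModSeq.pSeq U S₁ S₂).d (i + 1) = PMod.map (LinearMap.range (S₁.d (i + 1))).subtype
        (LinearMap.range (S₂.d (i + 1))).subtype ∘ₗ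
        PMod.map (S₁.d (i + 1)).rangeRestrict (S₂.d (i + 1)).rangeRestrict := by
      rw [PMod.map_comp]
      rfl
    rw [this]
    exact LinearMap.range_comp_of_range_eq_top _ (LinearMap.range_eq_top.2
      (PMod.map_surjective (LinearMap.surjective_rangeRestrict _)
        (LinearMap.surjective_rangeRestrict _)))
  exact ⟨(LinearEquiv.ofInjective _ h2).trans (LinearEquiv.ofEq _ _ h3.symm)⟩

/-- An isomorphism of pairs induces an isomorphism under `p`. -/
theorem PMod.nonempty_congr {M₁ M₂ N₁ N₂ : Type u} [AddCommGroup M₁] [Module A M₁]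
    [AddCommGroup M₂] [Module B M₂] [AddCommGroup N₁] [Module A N₁] [AddCommGroup N₂] [Module B N₂]
    (e₁ : M₁ ≃ₗ[A] N₁) (e₂ : M₂ ≃ₗ[B] N₂) :
    Nonempty (PMod A B U M₁ M₂ ≃ₗ[TriRing A B U] PMod A B U N₁ N₂) := by
  refine ⟨LinearEquiv.ofLinearMap (PMod.map e₁.toLinearMap e₂.toLinearMap)
    (PMod.map e₁.symm.toLinearMap e₂.symm.toLinearMap) ?_ ?_⟩ <;>
  · rw [PMod.map_comp, ← PMod.map_id]
    congr 1 <;> ext <;> simp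

theorem ModSeq.pSeq_isProjAdd {C₁ C₂ : Type u} [AddCommGroup C₁] [Module A C₁]
    [AddCommGroup C₂] [Module B C₂] {S₁ : ModSeq A} {S₂ : ModSeq B} (h₁ : S₁.IsProjAdd C₁)
    (h₂ : S₂.IsProjAdd C₂) : (ModSeq.pSeq U S₁ S₂).IsProjAdd (PMod A B U C₁ C₂) := by
  constructor
  · intro i hi
    have := h₁.1 i hi
    have := h₂.1 i hi
    exact PMod.projective (U := U) (M₁ := S₁.X i) (M₂ := S₂.X i)
  · intro i hi
    exact PMod.inAdd (U := U) (h₁.2 i hi) (h₂.2 i hi)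

theorem ModSeq.pSeq_isExact {S₁ : ModSeq A} {S₂ : ModSeq B} (h₁ : S₁.IsExact)
    (hU : S₁.TensorExact A B U) (h₂ : S₂.IsExact) : (ModSeq.pSeq U S₁ S₂).IsExact :=
  fun i => PMod.map_exact (h₁ i) (hU i) (h₂ i)

theorem ModSeq.pSeq_homAddExact {C₁ C₂ : Type u} [AddCommGroup C₁] [Module A C₁]
    [AddCommGroup C₂] [Module B C₂] {S₁ : ModSeq A} {S₂ : ModSeq B} (h₁ : S₁.HomAddExact C₁)
    (h₁₂ : ∀ Y : ModuleCat.{u} A, InAdd A C₁ Y → S₂.HomExact (BTensor A B U Y))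
    (h₂ : S₂.HomAddExact C₂) : (ModSeq.pSeq U S₁ S₂).HomAddExact (PMod A B U C₁ C₂) := by
  refine ModSeq.HomAddExact.of_finsupp fun I => ?_
  obtain ⟨e⟩ := PMod.nonempty_finsuppEquiv A B U C₁ C₂ I
  have h := ModSeq.pSeq_homExact
    (h₁ (ModuleCat.of A (I →₀ C₁)) (InAdd.finsupp_self C₁ I))
    (h₁₂ (ModuleCat.of A (I →₀ C₁)) (InAdd.finsupp_self C₁ I))
    (h₂ (ModuleCat.of B (I →₀ C₂)) (InAdd.finsupp_self C₂ I))
  exact h.of_retract e.toLinearMap e.symm.toLinearMap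
    (LinearMap.ext fun x => e.symm_apply_apply x)

/-- If `U` is weakly `C`-compatible, `p` preserves relative Gorenstein projectivity. -/
theorem IsWeaklyCCompatible.isGCProjective {C₁ C₂ M₁ M₂ : Type u} [AddCommGroup C₁] [Module A C₁]
    [AddCommGroup C₂] [Module B C₂] [AddCommGroup M₁] [Module A M₁] [AddCommGroup M₂] [Module B M₂]
    (hU : IsWeaklyCCompatible A B U C₁ C₂) (h₁ : IsGCProjective A C₁ M₁)
    (h₂ : IsGCProjective B C₂ M₂) :
    IsGCProjective (TriRing A B U) (PMod A B U C₁ C₂) (PMod A B U M₁ M₂) := by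
  obtain ⟨S₁, hP₁, hS₁, hC₁, ⟨e₁⟩⟩ := h₁
  obtain ⟨S₂, hP₂, hS₂, hC₂, ⟨e₂⟩⟩ := h₂
  have hT := hU.1 S₁ hP₁ hS₁ hC₁
  obtain ⟨e⟩ := PMod.nonempty_congr (U := U) e₁ e₂
  obtain ⟨e'⟩ := ModSeq.pSeq_nonempty_range_equiv (S₂ := S₂) hS₁ hT 0
  exact ⟨ModSeq.pSeq U S₁ S₂, ModSeq.pSeq_isProjAdd hP₁ hP₂, ModSeq.pSeq_isExact hS₁ hT hS₂,
    ModSeq.pSeq_homAddExact hC₁ (hU.2 S₂ hP₂ hS₂ hC₂) hC₂, ⟨e.trans e'⟩⟩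

/-- Maps into `Add_R(C)` extend along monomorphisms with `G_C`-projective cokernel. -/
theorem IsGCProjective.exists_extension {R C Z X M F : Type u} [Ring R] [AddCommGroup C]
    [Module R C] [AddCommGroup Z] [Module R Z] [AddCommGroup X] [Module R X] [AddCommGroup M]
    [Module R M] [AddCommGroup F] [Module R F] (hM : IsGCProjective R C M) (hF : InAdd R C F)
    {j : Z →ₗ[R] X} {p : X →ₗ[R] M} (hj : Function.Injective j) (hp : Function.Surjective p)
    (hjp : Function.Exact j p) (f : Z →ₗ[R] F) : ∃ g : X →ₗ[R] F, g ∘ₗ j = f := by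
  obtain ⟨I, s, r, hrs⟩ := hF
  have h := (hasProjResolution_iff _).1 ((isGCProjective_iff (ModuleCat.of R M)).1 hM).1 I 0
  obtain ⟨g, hg⟩ := exists_extension_of_ext_subsingleton (M := ModuleCat.of R Z)
    (X := ModuleCat.of R X) (F := ModuleCat.of R (I →₀ C)) hj hp hjp h (s ∘ₗ f)
  refine ⟨r ∘ₗ g, ?_⟩
  rw [LinearMap.comp_assoc, hg, ← LinearMap.comp_assoc, hrs, LinearMap.id_comp]

/-- If `p(Z, 0)` is `G_C`-projective, some map from `Z` to a direct sum of copies of `C₁` remains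
injective under `U ⊗_A -`. -/
theorem exists_btensorMap_injective {C₁ C₂ Z N : Type u} [AddCommGroup C₁] [Module A C₁]
    [AddCommGroup C₂] [Module B C₂] [AddCommGroup Z] [Module A Z] [AddCommGroup N] [Module B N]
    (h : IsGCProjective (TriRing A B U) (PMod A B U C₁ C₂) (PMod A B U Z N)) :
    ∃ (I : Type u) (f : Z →ₗ[A] (I →₀ C₁)), Function.Injective (btensorMap A B U f) := by
  obtain ⟨D, -, j, -, ⟨I, s, r, hrs⟩, -, ⟨hj, -, -, -⟩⟩ :=
    ((isGCProjective_iff (ModuleCat.of _ (PMod A B U Z N))).1 h).2.step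
  obtain ⟨e⟩ := PMod.nonempty_finsuppEquiv A B U C₁ C₂ I
  obtain ⟨f, g, hfg⟩ := PMod.exists_eq_lift (e.toLinearMap ∘ₗ s ∘ₗ j)
  have hs : Function.Injective s := Function.LeftInverse.injective (g := r) (LinearMap.congr_fun hrs)
  have hinj : Function.Injective (PMod.lift f g) := by
    rw [← hfg]
    exact e.injective.comp (hs.comp hj)
  -- On the part `U ⊗ Z` of `p(Z, N)` the embedding acts as `U ⊗ f`.
  refine ⟨I, f, (injective_iff_map_eq_zero _).2 fun t ht => ?_⟩
  have : PMod.lift f g (PMod.mk 0 (t, 0)) = 0 := by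
    rw [PMod.lift_mk, ht, map_zero, map_zero]
    exact PMod.mk_inj.2 ⟨rfl, by simp⟩
  have h0 := hinj (this.trans (map_zero _).symm)
  exact congrArg (fun m : PMod A B U Z N => m.2.1) h0

/-- The converse of `IsWeaklyCCompatible.isGCProjective`, when the images of the maps in complete
sequences are relatively Gorenstein projective. -/
theorem isWeaklyCCompatible_of_isGCProjective {C₁ C₂ : Type u} [AddCommGroup C₁] [Module A C₁]
    [AddCommGroup C₂] [Module B C₂]
    (h₁ : ∀ S : ModSeq A, S.IsProjAdd C₁ → S.IsExact → S.HomAddExact C₁ → ∀ i,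
      IsGCProjective A C₁ (LinearMap.range (S.d i)))
    (h₂ : ∀ S : ModSeq B, S.IsProjAdd C₂ → S.IsExact → S.HomAddExact C₂ → ∀ i,
      IsGCProjective B C₂ (LinearMap.range (S.d i)))
    (h : ∀ (M₁ M₂ : Type u) [AddCommGroup M₁] [Module A M₁] [AddCommGroup M₂] [Module B M₂],
      IsGCProjective A C₁ M₁ → IsGCProjective B C₂ M₂ →
        IsGCProjective (TriRing A B U) (PMod A B U C₁ C₂) (PMod A B U M₁ M₂)) :
    IsWeaklyCCompatible A B U C₁ C₂ := by
  constructor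
  · intro S hP hS hC i
    have hinj : Function.Injective
        (btensorMap A B U (LinearMap.range (S.d (i + 1))).subtype) := by
      obtain ⟨I, f, hf⟩ := exists_btensorMap_injective (h (LinearMap.range (S.d (i + 1))) PUnit
        (h₁ S hP hS hC (i + 1)) (isGCProjective_of_subsingleton C₂ PUnit))
      obtain ⟨g, hg⟩ := (ModSeq.isHomSES hS hC (i + 1)).ext (ModuleCat.of A (I →₀ C₁))
        (InAdd.finsupp_self C₁ I) f
      refine Function.Injective.of_comp (f := btensorMap A B U g) ?_
      rw [← LinearMap.coe_comp, ← btensorMap_comp, hg]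
      exact hf
    -- Right exactness identifies the kernel of the map onto `U ⊗ Z`, where `Z` is the image of `S.d
    -- (i + 1)`; `hinj` carries this over to `U ⊗ S.d (i + 1)`.
    have hex := btensorMap_exact (B := B) (U := U) (g := (S.d (i + 1)).rangeRestrict)
      (f := S.d i) (fun x => (Subtype.ext_iff).trans (hS i x))
      (LinearMap.surjective_rangeRestrict _)
    intro t
    rw [← hex t]
    have : btensorMap A B U (S.d (i + 1)) t = btensorMap A B U
        (LinearMap.range (S.d (i + 1))).subtype (btensorMap A B U (S.d (i + 1)).rangeRestrict t) :=
      btensorMap_comp_apply (LinearMap.range (S.d (i + 1))).subtype (S.d (i + 1)).rangeRestrict t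
    rw [this, map_eq_zero_iff _ hinj]
  · intro S hP hS hC Y hY i f
    constructor
    · intro hf
      -- A cocycle factors through the image of `S.d (i + 1)`; it remains to extend `f'` from there
      -- to the next term. This is done over `T`, for the sequence obtained by applying `p(0, -)`.
      obtain ⟨f', hf'⟩ := LinearMap.exists_comp_eq_of_ker_le (f := f)
        (LinearMap.surjective_rangeRestrict (S.d (i + 1))) (by
          intro x hx
          obtain ⟨y, rfl⟩ := (hS i x).1 (congrArg Subtype.val hx)
          exact LinearMap.congr_fun hf y)
      have hses := ModSeq.isHomSES hS hC (i + 1)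
      have hG := h PUnit (LinearMap.range (S.d (i + 1 + 1))) (isGCProjective_of_subsingleton C₁ PUnit)
        (h₂ S hP hS hC (i + 1 + 1))
      have hY' : InAdd (TriRing A B U) (PMod A B U C₁ C₂) (PMod A B U Y PUnit.{u + 1}) :=
        PMod.inAdd hY (InAdd.of_subsingleton C₂ PUnit)
      obtain ⟨k, hk⟩ := hG.exists_extension hY'
        (PMod.map_injective (f := (LinearMap.id : PUnit.{u + 1} →ₗ[A] PUnit.{u + 1}))
          Function.injective_id (Function.injective_of_subsingleton _) hses.inj)
        (PMod.map_surjective (f := (0 : PUnit.{u + 1} →ₗ[A] PUnit.{u + 1}))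
          (fun _ => ⟨0, rfl⟩) hses.surj)
        (PMod.map_exact (fun x => ⟨fun _ => ⟨x, rfl⟩, fun _ => rfl⟩)
          (fun t => ⟨fun _ => ⟨t, Subsingleton.elim _ _⟩, fun _ => Subsingleton.elim _ _⟩)
          hses.exact)
        (PMod.lift 0 (LinearMap.inl B _ _ ∘ₗ f'))
      obtain ⟨a, b, rfl⟩ := PMod.exists_eq_lift k
      rw [PMod.lift_comp_map, PMod.lift_eq_iff] at hk
      refine ⟨LinearMap.fst B _ _ ∘ₗ b, ?_⟩
      refine LinearMap.ext fun x => ?_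
      have e1 := LinearMap.congr_fun hk.2 ((S.d (i + 1)).rangeRestrict x)
      exact (congrArg Prod.fst e1).trans (LinearMap.congr_fun hf' x)
    · rintro ⟨g, rfl⟩
      refine LinearMap.ext fun x => ?_
      exact (congrArg g ((hS i).apply_apply_eq_zero x)).trans (map_zero g)

end Main

theorem mainTheorem7 (A B U : Type u) [Ring A] [Ring B] [AddCommGroup U] [Module B U]
    [Module Aᵐᵒᵖ U] [SMulCommClass B Aᵐᵒᵖ U] :
    (∀ (C₁ C₂ : Type u) [AddCommGroup C₁] [Module A C₁] [AddCommGroup C₂] [Module B C₂],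
      (IsWeaklyCCompatible A B U C₁ C₂ →
        ∀ (M₁ M₂ : Type u) [AddCommGroup M₁] [Module A M₁] [AddCommGroup M₂] [Module B M₂],
          IsGCProjective A C₁ M₁ → IsGCProjective B C₂ M₂ →
            IsGCProjective (TriRing A B U) (PMod A B U C₁ C₂) (PMod A B U M₁ M₂)) ∧
      (IsWTilting A C₁ → IsWTilting B C₂ →
        (∀ (M₁ M₂ : Type u) [AddCommGroup M₁] [Module A M₁] [AddCommGroup M₂] [Module B M₂],
          IsGCProjective A C₁ M₁ → IsGCProjective B C₂ M₂ →
            IsGCProjective (TriRing A B U) (PMod A B U C₁ C₂) (PMod A B U M₁ M₂)) →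
        IsWeaklyCCompatible A B U C₁ C₂)) ∧
    ((∀ (M₁ M₂ : Type u) [AddCommGroup M₁] [Module A M₁] [AddCommGroup M₂] [Module B M₂],
        IsGorensteinProjective A M₁ → IsGorensteinProjective B M₂ →
          IsGorensteinProjective (TriRing A B U) (PMod A B U M₁ M₂)) ↔
      IsWeaklyCompatible A B U) := by
  refine ⟨fun C₁ C₂ _ _ _ _ => ⟨fun hU M₁ M₂ _ _ _ _ h₁ h₂ => hU.isGCProjective h₁ h₂,
    fun h₁ h₂ h => isWeaklyCCompatible_of_isGCProjective h₁.isGCProjective_range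
      h₂.isGCProjective_range h⟩, ?_⟩
  -- Gorenstein projectivity is the relative notion for `A`, `B` and `p(A, B) ≅ T`, so both
  -- directions reduce to the relative results.
  have hA := isGorensteinProjective_iff (R := A) (C := A) (fun X => inAdd_self_iff X)
  have hB := isGorensteinProjective_iff (R := B) (C := B) (fun X => inAdd_self_iff X)
  have hT := isGorensteinProjective_iff (R := TriRing A B U) PMod.inAdd_iff_projective
  constructor
  · intro h
    refine isWeaklyCCompatible_of_isGCProjective isGCProjective_range_of_self
      isGCProjective_range_of_self fun M₁ M₂ _ _ _ _ h₁ h₂ => ?_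
    exact (hT _).1 (h M₁ M₂ ((hA M₁).2 h₁) ((hB M₂).2 h₂))
  · intro hU M₁ M₂ _ _ _ _ h₁ h₂
    exact (hT _).2 (IsWeaklyCCompatible.isGCProjective hU ((hA M₁).1 h₁) ((hB M₂).1 h₂))
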